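/- Let $p$ be a prime, $k=\overline{\mathbb F}_p$, $G=\mathrm{GL}_2(\mathbb Q_p)$, $K=\mathrm{GL}_2(\mathbb Z_p)$, $\alpha=\begin{pmatrix}1&0\\0&p\end{pmatrix}$, $\beta=\begin{pmatrix}p&0\\0&p\end{pmatrix}$ and $I=K\cap\alpha K\alpha^{-1}$. Let $G^+\subseteq G$ be the submonoid of matrices with entries in $\mathbb Z_p$, and $G^-=(G^+)^{-1}$. For $r\ge 0$ the monoid $G^+$ acts on $\mathrm{Sym}^r(k^2)$ through reduction modulo $p$, hence $G^-$ acts on the dual $\mathrm{Sym}^r(k^2)^\vee$ by $(g\ell)(m)=\ell(g^{-1}m)$; for $r=0$ this is the trivial representation $k$. For an open subgroup $H\subseteq G$ (or $H\subseteq K$) and a representation $V$ of $H$, let $[g,v]$ denote the element of the compact induction $\mathrm{c\text{-}Ind}_H^G V$ that is supported on $gH$ and maps $g$ to $v$. For $V=\mathrm{Sym}^r(k^2)^\vee$ define operators on $\mathrm{c\text{-}Ind}_K^G V$ by $$T[g,v]=\sum_{x\in K/I}[gx\alpha,\alpha^{-1}x^{-1}v],\qquad S[g,v]=[\beta g,v].$$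 For $\lambda\in k$ and a character $\chi\colon\mathbb Q_p^\times\to k^\times$ put $$\pi(r,\lambda,\chi)=\frac{\mathrm{c\text{-}Ind}_K^G(\mathrm{Sym}^r(k^2)^\vee)}{(T-\lambda,S-1)}\otimes(\chi\omega^r\circ\det),$$ where $\omega(x)=x|x| \bmod p$. Define $\phi_1,\phi_2\colon\mathrm{c\text{-}Ind}_I^G(k)\to\mathrm{c\text{-}Ind}_K^G(k)$ by $\phi_1([g,a])=[g,a]$ and $\phi_2([g,a])=[g\alpha,a]$. Embed $k$ and $\mathrm{Sym}^{p-1}(k^2)^\vee$ $K$-equivariantly in $\mathrm{c\text{-}Ind}_I^K(k)$, by sending $a\in k$ to the constant function $a$, and $\ell$ to the function $\begin{pmatrix}a&b\\c&d\end{pmatrix}\mapsto\ell\big((\bar a,\bar c)^{p-1}\big)$, that is, $\ell$ viewed as a homogeneous polynomial function of degree $p-1$ and evaluated at the reduction of $(a,c)$ modulo $p$. Consider the composite $$\mathrm{c\text{-}Ind}_K^G(k)\oplus\mathrm{c\text{-}Ind}_K^G(\mathrm{Sym}^{p-1}(k^2)^\vee)\to\mathrm{c\text{-}Ind}_K^G(\mathrm{c\text{-}Ind}_I^K(k))\xrightarrow{\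 \sim\ }\mathrm{c\text{-}Ind}_I^G(k)\xrightarrow{(\phi_1,\phi_2)}\mathrm{c\text{-}Ind}_K^G(k)\oplus\mathrm{c\text{-}Ind}_K^G(k),$$ where the middle map is $[g,[\kappa,a]]\mapsto[g\kappa,a]$, and let $\phi\colon\mathrm{c\text{-}Ind}_K^G(\mathrm{Sym}^{p-1}(k^2)^\vee)\to\mathrm{c\text{-}Ind}_K^G(k)$ be its component from the second summand to the second summand. Then the composite is of the form $\begin{pmatrix}1&0\\T&\phi\end{pmatrix}$, the map $\phi$ commutes with $T$, $S$ and the action of $G$, and the reduction of $\phi$ modulo $(T-1,S-1)$ is a well-defined, nonzero, $G$-equivariant map $\pi(p-1,1,1)\to\pi(0,1,1)$. -/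

import Mathlib

open scoped LinearAlgebra.Projectivization

noncomputable section

namespace ModPGL2

/-! ### Compact induction from an open subgroup -/

section CInd

variable {k G V W : Type*} [Field k] [Group G] [AddCommGroup V] [Module k V]
  [AddCommGroup W] [Module k W]

/-- The compact induction `c-Ind_H^G V`: the functions `f : G → V` with `f (g h) = h⁻¹ f(g)` for
`h ∈ H` whose support meets only finitely many left cosets of `H`.  (When `H` is an open subgroup
of a locally profinite group, this is the same as compact support modulo `H`; when moreover `V` is
a smooth representation of `H`, all such functions are automatically smooth.) -/
def cInd (H : Subgroup G) (σ : Representation k H V) : Submodule k (G → V) where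
  carrier := {f | (∀ (g : G) (h : H), f (g * h) = σ h⁻¹ (f g)) ∧
    ((fun g : G => (g : G ⧸ H)) '' Function.support f).Finite}
  add_mem' := by
    rintro a b ⟨ha, ha'⟩ ⟨hb, hb'⟩
    refine ⟨fun g h => by simp [ha, hb], (ha'.union hb').subset ?_⟩
    rw [← Set.image_union]
    exact Set.image_mono (Function.support_add a b)
  zero_mem' := ⟨fun g h => by simp, by simp⟩
  smul_mem' := by
    rintro c a ⟨ha, ha'⟩
    exact ⟨fun g h => by simp [ha], ha'.subset (Set.image_mono (Function.support_const_smul_subset c a))⟩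

variable {H : Subgroup G} (σ : Representation k H V)

/-- The action of `G` on `c-Ind_H^G V` by left translation, `(g f)(x) = f (g⁻¹ x)`. -/
def cIndRep : Representation k G (cInd H σ) where
  toFun g :=
    { toFun := fun f => ⟨fun x => f.1 (g⁻¹ * x), by
        obtain ⟨f, hf, hf'⟩ := f
        refine ⟨fun x h => by simp only [← mul_assoc]; exact hf _ h, ?_⟩
        refine (hf'.image (fun c => g • c)).subset ?_
        rintro _ ⟨x, hx, rfl⟩
        exact ⟨((g⁻¹ * x : G) : G ⧸ H), ⟨_, hx, rfl⟩, by
          simp⟩⟩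
      map_add' := fun _ _ => rfl
      map_smul' := fun _ _ => rfl }
  map_one' := by ext f x; simp
  map_mul' a b := by ext f x; simp [mul_assoc]

@[simp]
theorem cIndRep_apply (g x : G) (f : cInd H σ) : (cIndRep σ g f).1 x = f.1 (g⁻¹ * x) := rfl

open Classical in
/-- The element `[g, v]` of `c-Ind_H^G V`, supported on `g H` and sending `g` to `v`. -/
def single (g : G) : V →ₗ[k] cInd H σ where
  toFun v := ⟨fun x => if h : g⁻¹ * x ∈ H then σ (⟨g⁻¹ * x, h⟩ : H)⁻¹ v else 0, by
    refine ⟨fun x h => ?_, (Set.finite_singleton (g : G ⧸ H)).subset ?_⟩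
    · by_cases hx : g⁻¹ * x ∈ H
      · have h2 : g⁻¹ * (x * h) ∈ H := by
          rw [← mul_assoc]; exact H.mul_mem hx h.2
        dsimp only
        rw [dif_pos hx, dif_pos h2]
        have : (⟨g⁻¹ * (x * h), h2⟩ : H) = ⟨g⁻¹ * x, hx⟩ * h := by
          ext; simp [mul_assoc]
        rw [this, mul_inv_rev, map_mul]; rfl
      · have h2 : g⁻¹ * (x * h) ∉ H := fun h2 => hx <| by
          have := H.mul_mem h2 (H.inv_mem h.2)
          simpa [mul_assoc] using this
        dsimp only
        rw [dif_neg hx, dif_neg h2, map_zero]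
    · rintro _ ⟨x, hx, rfl⟩
      by_contra hne
      have : g⁻¹ * x ∉ H := fun h => hne (QuotientGroup.eq.2 h).symm
      exact hx (dif_neg this)⟩
  map_add' v w := by
    ext x; dsimp only [Submodule.coe_add, Pi.add_apply]; split_ifs <;> simp
  map_smul' c v := by
    ext x; dsimp only [Submodule.coe_smul, Pi.smul_apply, RingHom.id_apply]; split_ifs <;> simp

open Classical in
theorem single_apply (g x : G) (v : V) :
    (single σ g v).1 x = if h : g⁻¹ * x ∈ H then σ (⟨g⁻¹ * x, h⟩ : H)⁻¹ v else 0 := rfl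

/-- `[g h, v] = [g, h v]` for `h ∈ H`. -/
theorem single_mul (g : G) (h : H) (v : V) :
    single σ (g * h) v = single σ g (σ h v) := by
  ext x
  rw [single_apply, single_apply]
  by_cases hx : g⁻¹ * x ∈ H
  · have h2 : (g * h)⁻¹ * x ∈ H := by
      rw [mul_inv_rev, mul_assoc]; exact H.mul_mem (H.inv_mem h.2) hx
    rw [dif_pos hx, dif_pos h2]
    have : (⟨(g * h)⁻¹ * x, h2⟩ : H) = h⁻¹ * ⟨g⁻¹ * x, hx⟩ := by
      ext; simp [mul_assoc]
    rw [this, mul_inv_rev, inv_inv, map_mul]; rfl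
  · have h2 : (g * h)⁻¹ * x ∉ H := fun h2 => hx <| by
      have := H.mul_mem h.2 h2
      simpa [mul_assoc] using this
    rw [dif_neg hx, dif_neg h2]

/-- `g [g', v] = [g g', v]`. -/
theorem cIndRep_single (g g' : G) (v : V) :
    cIndRep σ g (single σ g' v) = single σ (g * g') v := by
  ext x
  have : (g * g')⁻¹ * x = g'⁻¹ * (g⁻¹ * x) := by rw [mul_inv_rev, mul_assoc]
  rw [cIndRep_apply, single_apply, single_apply]
  by_cases h : g'⁻¹ * (g⁻¹ * x) ∈ H
  · rw [dif_pos h, dif_pos (this ▸ h)]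
    congr 4
    exact this.symm
  · rw [dif_neg h, dif_neg (this ▸ h)]

theorem finite_support_lift (F : G → V →ₗ[k] W) (f : cInd H σ) :
    Function.HasFiniteSupport (fun c : G ⧸ H => F c.out (f.1 c.out)) := by
  refine f.2.2.subset ?_
  intro c hc
  refine ⟨c.out, fun h0 => hc ?_, QuotientGroup.out_eq' c⟩
  change F c.out (f.1 c.out) = 0
  rw [h0, map_zero]

/-- The linear map on `c-Ind_H^G V` determined by `[g, v] ↦ F g v`, for a family `F` that respects
the relations `[g h, v] = [g, h v]`; it sends `f` to the sum of `F g (f g)` over `g ∈ G / H`. -/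
def lift (F : G → V →ₗ[k] W) (_hF : ∀ (g : G) (h : H) (v : V), F (g * h) v = F g (σ h v)) :
    cInd H σ →ₗ[k] W where
  toFun f := ∑ᶠ c : G ⧸ H, F c.out (f.1 c.out)
  map_add' f f' := by
    rw [← finsum_add_distrib (finite_support_lift σ F f) (finite_support_lift σ F f')]
    simp
  map_smul' c f := by
    rw [RingHom.id_apply, smul_finsum' c (finite_support_lift σ F f)]
    simp

/-- The defining formula of `lift`. -/
theorem lift_single (F : G → V →ₗ[k] W)
    (hF : ∀ (g : G) (h : H) (v : V), F (g * h) v = F g (σ h v)) (g : G) (v : V) :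
    lift σ F hF (single σ g v) = F g v := by
  change ∑ᶠ c : G ⧸ H, F c.out ((single σ g v).1 c.out) = F g v
  have hg : g⁻¹ * (g : G ⧸ H).out ∈ H := QuotientGroup.eq.1 (QuotientGroup.out_eq' _).symm
  rw [finsum_eq_single _ (g : G ⧸ H)]
  · rw [single_apply, dif_pos hg]
    have := hF g ⟨_, hg⟩ (σ (⟨_, hg⟩ : H)⁻¹ v)
    rw [← Module.End.mul_apply, ← map_mul, mul_inv_cancel, map_one, Module.End.one_apply] at this
    rw [← this]
    simp
  · intro c hc
    rw [single_apply, dif_neg, map_zero]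
    intro h
    exact hc ((QuotientGroup.out_eq' c).symm.trans (QuotientGroup.eq.2 h).symm)

/-- The elements `[g, v]` span `c-Ind_H^G V`. -/
theorem cInd_ext {A B : cInd H σ →ₗ[k] W}
    (h : ∀ g v, A (single σ g v) = B (single σ g v)) : A = B := by
  ext f
  have hfin := finite_support_lift σ (fun g => single σ g) f
  have key : f = ∑ᶠ c : G ⧸ H, single σ c.out (f.1 c.out) := by
    ext x
    have h1 : (∑ᶠ c : G ⧸ H, single σ c.out (f.1 c.out)).1 x
        = ∑ᶠ c : G ⧸ H, (single σ c.out (f.1 c.out)).1 x :=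
      AddMonoidHom.map_finsum (((LinearMap.proj x).comp (cInd H σ).subtype).toAddMonoidHom) hfin
    have hx : (x : G ⧸ H).out⁻¹ * x ∈ H := QuotientGroup.eq.1 (QuotientGroup.out_eq' _)
    rw [h1, finsum_eq_single _ (x : G ⧸ H)]
    · rw [single_apply, dif_pos hx, ← f.2.1]
      simp
    · intro c hc
      rw [single_apply, dif_neg]
      intro h
      exact hc ((QuotientGroup.out_eq' c).symm.trans (QuotientGroup.eq.2 h))
  have hA := AddMonoidHom.map_finsum A.toAddMonoidHom hfin
  have hB := AddMonoidHom.map_finsum B.toAddMonoidHom hfin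
  rw [key]
  simp only [LinearMap.toAddMonoidHom_coe] at hA hB
  rw [hA, hB]
  simp only [h]

theorem finsum_reindex {ι : Type*} [Finite ι] (e : Equiv.Perm ι) (A B : ι → V →ₗ[k] W)
    (L : V →ₗ[k] V) (h : ∀ x, A x = B (e x) ∘ₗ L) : ∑ᶠ x, A x = (∑ᶠ x, B x) ∘ₗ L := by
  cases nonempty_fintype ι
  rw [finsum_eq_sum_of_fintype, finsum_eq_sum_of_fintype, Finset.sum_congr rfl fun x _ => h x,
    ← Equiv.sum_comp e B]
  ext1 v
  simp only [LinearMap.sum_apply, LinearMap.comp_apply]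

/-- The map `c-Ind_H^G V → c-Ind_H^G W`, `[g, v] ↦ [g, τ v]`, induced by an `H`-equivariant map
`τ : V → W`. -/
def cIndMap (σ' : Representation k H W) (τ : V →ₗ[k] W) (hτ : ∀ h v, τ (σ h v) = σ' h (τ v)) :
    cInd H σ →ₗ[k] cInd H σ' :=
  lift σ (fun g => single σ' g ∘ₗ τ) (fun g h v => by
    simp only [LinearMap.comp_apply, hτ, single_mul])

/-- Transitivity of compact induction for a trivial representation, the map
`c-Ind_K^G (c-Ind_J^K k) → c-Ind_J^G k`, `[g, [κ, a]] ↦ [g κ, a]`, for `J ≤ K ≤ G`. -/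
def cIndTrans (k : Type*) [Field k] (J K : Subgroup G) (_hJK : J ≤ K) :
    cInd K (cIndRep (Representation.trivial k (J.subgroupOf K) k)) →ₗ[k]
      cInd J (Representation.trivial k J k) :=
  lift _
    (fun g => lift _ (fun κ : K => single (Representation.trivial k J k) (g * κ))
      (fun κ j v => by
        have := single_mul (Representation.trivial k J k) (g * κ) ⟨((j : K) : G), j.2⟩ v
        simpa [mul_assoc] using this))
    (fun g κ f => by
      have : lift (Representation.trivial k (J.subgroupOf K) k)
          (fun κ' : K => single (Representation.trivial k J k) (g * κ * κ')) (fun κ' j v => by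
            have := single_mul (Representation.trivial k J k) (g * κ * κ') ⟨((j : K) : G), j.2⟩ v
            simpa [mul_assoc] using this) =
        (lift (Representation.trivial k (J.subgroupOf K) k)
          (fun κ' : K => single (Representation.trivial k J k) (g * κ')) (fun κ' j v => by
            have := single_mul (Representation.trivial k J k) (g * κ') ⟨((j : K) : G), j.2⟩ v
            simpa [mul_assoc] using this)) ∘ₗ cIndRep _ κ := by
        apply cInd_ext
        intro κ' v
        rw [LinearMap.comp_apply, cIndRep_single, lift_single, lift_single]
        simp [mul_assoc]
      exact congr($this f))

end CInd

/-! ### The groups -/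

section Groups

variable (p : ℕ) [Fact p.Prime]

/-- `G = GL₂(ℚ_p)`. -/
abbrev G : Type := GL (Fin 2) ℚ_[p]

/-- `K = GL₂(ℤ_p)`, as a subgroup of `G`. -/
def K : Subgroup (G p) := (Matrix.GeneralLinearGroup.map (algebraMap ℤ_[p] ℚ_[p])).range

theorem p_ne_zero : (p : ℚ_[p]) ≠ 0 := Nat.cast_ne_zero.2 (Fact.out : p.Prime).ne_zero

/-- `α = diag(1, p)`. -/
def α : G p := Matrix.GeneralLinearGroup.mkOfDetNeZero !![1, 0; 0, (p : ℚ_[p])]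
  (by simpa using (Fact.out : p.Prime).ne_zero)

/-- `β = diag(p, p)`. -/
def β : G p := Matrix.GeneralLinearGroup.mkOfDetNeZero !![(p : ℚ_[p]), 0; 0, (p : ℚ_[p])]
  (by simpa using (Fact.out : p.Prime).ne_zero)

/-- The Iwahori subgroup `I = K ∩ α K α⁻¹`. -/
def I : Subgroup (G p) := K p ⊓ (K p).map (MulAut.conj (α p)).toMonoidHom

/-- `G⁺`, the submonoid of matrices in `G` with entries in `ℤ_p`. -/
def Gplus : Submonoid (G p) where
  carrier := {g | ∀ i j, ‖(g : Matrix (Fin 2) (Fin 2) ℚ_[p]) i j‖ ≤ 1}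
  one_mem' i j := by
    by_cases h : i = j <;> simp [h]
  mul_mem' {a b} ha hb i j := by
    have : ∀ l, (a : Matrix (Fin 2) (Fin 2) ℚ_[p]) i l * (b : Matrix (Fin 2) (Fin 2) ℚ_[p]) l j
        ∈ PadicInt.subring p := fun l =>
      (PadicInt.subring p).mul_mem (ha i l) (hb l j)
    have h2 := (PadicInt.subring p).sum_mem (t := Finset.univ) (fun l _ => this l)
    simpa [Matrix.mul_apply] using h2

/-- `G⁻ = (G⁺)⁻¹`. -/
def Gminus : Submonoid (G p) where
  carrier := {g | g⁻¹ ∈ Gplus p}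
  one_mem' := by simp
  mul_mem' {a b} ha hb := by
    simpa only [Set.mem_ofPred_eq, mul_inv_rev] using (Gplus p).mul_mem hb ha

/-- An element `x` of `ℚ_p` with `|x| ≤ 1`, as an element of `ℤ_p`. -/
def toInt (x : ℚ_[p]) (hx : ‖x‖ ≤ 1) : ℤ_[p] := ⟨x, hx⟩

@[simp]
theorem coe_toInt (x : ℚ_[p]) (hx : ‖x‖ ≤ 1) : (toInt p x hx : ℚ_[p]) = x := rfl

/-- A matrix in `G⁺`, as a matrix over `ℤ_p`. -/
def intMat : Gplus p →* Matrix (Fin 2) (Fin 2) ℤ_[p] where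
  toFun g := Matrix.of fun i j => toInt p ((g.1 : Matrix (Fin 2) (Fin 2) ℚ_[p]) i j) (g.2 i j)
  map_one' := by
    ext i j
    refine PadicInt.ext ?_
    rw [Matrix.of_apply, coe_toInt]
    by_cases h : i = j
    · subst h; simp
    · simp [Matrix.one_apply_ne h]
  map_mul' a b := by
    ext i j
    refine PadicInt.ext ?_
    simp only [Matrix.of_apply, coe_toInt, Matrix.mul_apply, Fin.sum_univ_two, PadicInt.coe_add,
      PadicInt.coe_mul, Submonoid.coe_mul, Units.val_mul]

/-- Reduction modulo `p` of the entries of a matrix in `G⁺`. -/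
def red : Gplus p →* Matrix (Fin 2) (Fin 2) (ZMod p) :=
  ((PadicInt.toZMod (p := p)).mapMatrix : _ →+* _).toMonoidHom.comp (intMat p)

theorem K_le_Gplus : (K p).toSubmonoid ≤ Gplus p := by
  rintro _ ⟨u, rfl⟩ i j
  exact PadicInt.norm_le_one _

theorem mem_K_iff (g : G p) : g ∈ K p ↔ g ∈ Gplus p ∧ g⁻¹ ∈ Gplus p := by
  constructor
  · exact fun h => ⟨K_le_Gplus p h, K_le_Gplus p ((K p).inv_mem h)⟩
  · rintro ⟨h, h'⟩
    have h1 : (⟨g, h⟩ : Gplus p) * ⟨g⁻¹, h'⟩ = 1 := by ext1; simp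
    have h2 : (⟨g⁻¹, h'⟩ : Gplus p) * ⟨g, h⟩ = 1 := by ext1; simp
    refine ⟨⟨intMat p ⟨g, h⟩, intMat p ⟨g⁻¹, h'⟩, ?_, ?_⟩, ?_⟩
    · rw [← map_mul, h1, map_one]
    · rw [← map_mul, h2, map_one]
    · ext i j
      rfl

/-- The inclusion `K ⊆ G⁺`. -/
def KtoGplus : K p →* Gplus p := (K p).subtype.codRestrict (Gplus p) fun g => K_le_Gplus p g.2

/-- The inclusion `K ⊆ G⁻`. -/
def KtoGminus : K p →* Gminus p :=
  (K p).subtype.codRestrict (Gminus p) fun g => K_le_Gplus p ((K p).inv_mem g.2)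

theorem α_mem_Gplus : α p ∈ Gplus p := by
  intro i j
  change ‖!![1, 0; 0, (p : ℚ_[p])] i j‖ ≤ 1
  have h := (Padic.norm_p_lt_one (p := p)).le
  fin_cases i <;> fin_cases j
  · simp
  · simp
  · simp
  · exact h

theorem α_val : (α p).1 = !![1, 0; 0, (p : ℚ_[p])] := rfl

theorem α_inv_val : ((α p)⁻¹).1 = !![1, 0; 0, (p : ℚ_[p])⁻¹] := by
  have hp := p_ne_zero p
  have h : (α p).1 * !![1, 0; 0, (p : ℚ_[p])⁻¹] = 1 := by
    rw [α_val]; ext i j; fin_cases i <;> fin_cases j <;> simp [hp]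
  calc ((α p)⁻¹).1 = ((α p)⁻¹).1 * ((α p).1 * !![1, 0; 0, (p : ℚ_[p])⁻¹]) := by rw [h, mul_one]
    _ = _ := by rw [← mul_assoc, ← Units.val_mul, inv_mul_cancel, Units.val_one, one_mul]

theorem I_le_K : I p ≤ K p := inf_le_left

theorem conj_mem_K_of_mem_I {i : G p} (hi : i ∈ I p) : (α p)⁻¹ * i * α p ∈ K p := by
  obtain ⟨κ, hκ, rfl⟩ := hi.2
  simpa [mul_assoc] using hκ

/-- The element `α⁻¹ x⁻¹` of `G⁻`, for `x ∈ K`. -/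
def αInv (x : K p) : Gminus p := ⟨(α p)⁻¹ * (x : G p)⁻¹, by
  change ((α p)⁻¹ * (x : G p)⁻¹)⁻¹ ∈ Gplus p
  rw [mul_inv_rev, inv_inv, inv_inv]
  exact (Gplus p).mul_mem (K_le_Gplus p x.2) (α_mem_Gplus p)⟩

theorem toZMod_eq_zero_iff (x : ℤ_[p]) : PadicInt.toZMod x = 0 ↔ ‖(x : ℚ_[p]) / p‖ ≤ 1 := by
  have hp := p_ne_zero p
  rw [← RingHom.mem_ker, PadicInt.ker_toZMod, PadicInt.maximalIdeal_eq_span_p,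
    Ideal.mem_span_singleton]
  constructor
  · rintro ⟨y, rfl⟩
    rw [PadicInt.coe_mul, PadicInt.coe_natCast, mul_div_cancel_left₀ _ hp]
    exact y.2
  · intro h
    refine ⟨toInt p _ h, PadicInt.ext ?_⟩
    rw [PadicInt.coe_mul, PadicInt.coe_natCast, coe_toInt]
    exact (mul_div_cancel₀ _ hp).symm

theorem conj_α_mem_Gplus_iff {g : G p} (hg : g ∈ Gplus p) :
    (α p)⁻¹ * g * α p ∈ Gplus p ↔ red p ⟨g, hg⟩ 1 0 = 0 := by
  have hv : ((α p)⁻¹ * g * α p).1 = !![g.1 0 0, g.1 0 1 * p; g.1 1 0 / p, g.1 1 1] := by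
    have hp := p_ne_zero p
    rw [Units.val_mul, Units.val_mul, α_val, α_inv_val]
    ext i j
    rw [Matrix.mul_apply, Fin.sum_univ_two, Matrix.mul_apply, Fin.sum_univ_two, Matrix.mul_apply,
      Fin.sum_univ_two]
    fin_cases i <;> fin_cases j <;> simp <;> field_simp
  have h1 : red p ⟨g, hg⟩ 1 0 = PadicInt.toZMod (toInt p (g.1 1 0) (hg 1 0)) := rfl
  refine Iff.trans ?_ (toZMod_eq_zero_iff p (toInt p (g.1 1 0) (hg 1 0))).symm
  constructor
  · intro h
    have := h 1 0
    rw [hv] at this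
    exact this
  · intro h i j
    rw [hv]
    fin_cases i <;> fin_cases j
    · exact hg 0 0
    · exact (PadicInt.subring p).mul_mem (hg 0 1) (by
        exact Padic.norm_p_lt_one.le)
    · exact h
    · exact hg 1 1

instance : Finite (K p ⧸ (I p).subgroupOf (K p)) := by
  refine Finite.of_injective (fun c => red p (KtoGplus p c.out)) ?_
  intro c d hcd
  rw [← QuotientGroup.out_eq' c, ← QuotientGroup.out_eq' d, QuotientGroup.eq,
    Subgroup.mem_subgroupOf]
  have hcd : red p (KtoGplus p c.out) = red p (KtoGplus p d.out) := hcd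
  have key : ∀ x y : K p, red p (KtoGplus p x) = red p (KtoGplus p y) →
      (α p)⁻¹ * ((x⁻¹ * y : K p) : G p) * α p ∈ Gplus p := by
    intro x y h
    rw [conj_α_mem_Gplus_iff p (K_le_Gplus p (x⁻¹ * y).2)]
    have : red p (KtoGplus p (x⁻¹ * y)) = 1 := by
      rw [map_mul, map_mul, ← h, ← map_mul, ← map_mul, inv_mul_cancel, map_one, map_one]
    exact congr_fun (congr_fun this 1) 0
  refine ⟨(c.out⁻¹ * d.out : K p).2, (α p)⁻¹ * ((c.out⁻¹ * d.out : K p) : G p) * α p, ?_, ?_⟩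
  · refine (mem_K_iff p _).2 ⟨key _ _ hcd, ?_⟩
    have := key _ _ hcd.symm
    simpa [mul_assoc] using this
  · simp [mul_assoc]

end Groups

/-! ### Hecke operators and the representations `π` -/

section Hecke

variable (p : ℕ) [Fact p.Prime] {k : Type*} [Field k] {V : Type*} [AddCommGroup V] [Module k V]

/-- The restriction to `K` of a representation of the monoid `G⁻`. -/
def resK (σ : Representation k (Gminus p) V) : Representation k (K p) V := σ.comp (KtoGminus p)

variable {p}
variable (σ : Representation k (Gminus p) V)

/-- `[g x α, α⁻¹ x⁻¹ v]`, the summand of `T [g, v]` indexed by the coset `x I`. -/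
def heckeTerm (g : G p) (x : K p) : V →ₗ[k] cInd (K p) (resK p σ) :=
  single (resK p σ) (g * x * α p) ∘ₗ σ (αInv p x)

theorem heckeTerm_mul (g : G p) (x : K p) (i : K p) (hi : (i : G p) ∈ I p) :
    heckeTerm σ g (x * i) = heckeTerm σ g x := by
  ext1 v
  have hj := conj_mem_K_of_mem_I p hi
  have h1 : g * ((x * i : K p) : G p) * α p = g * x * α p * ((⟨_, hj⟩ : K p) : G p) := by
    simp [mul_assoc]
  rw [heckeTerm, heckeTerm, LinearMap.comp_apply, LinearMap.comp_apply, h1, single_mul]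
  congr 1
  change (σ _ * σ _) v = _
  rw [← map_mul]
  congr 2
  ext1
  change (α p)⁻¹ * (i : G p) * α p * ((α p)⁻¹ * ((x * i : K p) : G p)⁻¹) = (α p)⁻¹ * (x : G p)⁻¹
  simp [mul_assoc]

theorem heckeTerm_out (g : G p) (y : K p) :
    heckeTerm σ g (y : K p ⧸ (I p).subgroupOf (K p)).out = heckeTerm σ g y := by
  have hy : y⁻¹ * (y : K p ⧸ (I p).subgroupOf (K p)).out ∈ (I p).subgroupOf (K p) :=
    QuotientGroup.eq.1 (QuotientGroup.out_eq' _).symm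
  rw [← heckeTerm_mul σ g y _ (Subgroup.mem_subgroupOf.1 hy), mul_inv_cancel_left]

theorem heckeTerm_shift (g : G p) (κ : K p) (x : K p) :
    heckeTerm σ (g * κ) x = heckeTerm σ g (κ * x) ∘ₗ resK p σ κ := by
  ext1 v
  rw [heckeTerm, heckeTerm, LinearMap.comp_apply, LinearMap.comp_apply, LinearMap.comp_apply,
    Subgroup.coe_mul, ← mul_assoc]
  congr 1
  change _ = (σ _ * σ _) v
  rw [← map_mul]
  congr 2
  ext1
  change (α p)⁻¹ * (x : G p)⁻¹ = (α p)⁻¹ * ((κ * x : K p) : G p)⁻¹ * (κ : G p)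
  rw [Subgroup.coe_mul, mul_inv_rev, mul_assoc, mul_assoc, inv_mul_cancel, mul_one]

theorem heckeTerm_sum (g : G p) (κ : K p) :
    ∑ᶠ x : K p ⧸ (I p).subgroupOf (K p), heckeTerm σ (g * κ) x.out =
      (∑ᶠ x : K p ⧸ (I p).subgroupOf (K p), heckeTerm σ g x.out) ∘ₗ resK p σ κ := by
  have hterm : ∀ x : K p ⧸ (I p).subgroupOf (K p), heckeTerm σ (g * κ) x.out =
      heckeTerm σ g (κ • x).out ∘ₗ resK p σ κ := by
    intro x
    have hx : κ • x = ((κ * x.out : K p) : K p ⧸ (I p).subgroupOf (K p)) := by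
      have h := MulAction.Quotient.smul_coe ((I p).subgroupOf (K p)) κ x.out
      rw [QuotientGroup.out_eq' x] at h
      exact h
    rw [heckeTerm_shift, hx, heckeTerm_out]
  exact finsum_reindex (MulAction.toPerm κ) (fun x : K p ⧸ (I p).subgroupOf (K p) =>
    heckeTerm σ (g * κ) x.out) (fun x => heckeTerm σ g x.out) (resK p σ κ) hterm

/-- The Hecke operator `T [g, v] = ∑_{x ∈ K / I} [g x α, α⁻¹ x⁻¹ v]`; the summand only depends on
the coset of `x`, by `heckeTerm_mul`. -/
def T : cInd (K p) (resK p σ) →ₗ[k] cInd (K p) (resK p σ) :=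
  lift (resK p σ) (fun g => ∑ᶠ x : K p ⧸ (I p).subgroupOf (K p), heckeTerm σ g x.out)
    (fun g κ v => congr($(heckeTerm_sum σ g κ) v))

/-- The Hecke operator `S [g, v] = [β g, v]`. -/
def S : cInd (K p) (resK p σ) →ₗ[k] cInd (K p) (resK p σ) := cIndRep (resK p σ) (β p)

theorem T_single (g : G p) (v : V) : T σ (single (resK p σ) g v) =
    ∑ᶠ x : K p ⧸ (I p).subgroupOf (K p),
      single (resK p σ) (g * x.out * α p) (σ (αInv p x.out) v) := by
  rw [T, lift_single]
  cases nonempty_fintype (K p ⧸ (I p).subgroupOf (K p))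
  rw [finsum_eq_sum_of_fintype, finsum_eq_sum_of_fintype, LinearMap.sum_apply]
  rfl

theorem T_comm (g : G p) : T σ ∘ₗ cIndRep (resK p σ) g = cIndRep (resK p σ) g ∘ₗ T σ := by
  apply cInd_ext
  intro g' v
  rw [LinearMap.comp_apply, LinearMap.comp_apply, cIndRep_single, T_single, T_single]
  cases nonempty_fintype (K p ⧸ (I p).subgroupOf (K p))
  rw [finsum_eq_sum_of_fintype, finsum_eq_sum_of_fintype, map_sum]
  simp only [cIndRep_single, mul_assoc]

theorem β_comm (g : G p) : β p * g = g * β p := by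
  have h : (β p).1 = !![(p : ℚ_[p]), 0; 0, (p : ℚ_[p])] := rfl
  ext i j
  rw [Units.val_mul, Units.val_mul, h]
  fin_cases i <;> fin_cases j <;> simp [Matrix.mul_apply, Fin.sum_univ_two, mul_comm]

theorem S_comm (g : G p) : S σ ∘ₗ cIndRep (resK p σ) g = cIndRep (resK p σ) g ∘ₗ S σ := by
  change cIndRep (resK p σ) (β p) * cIndRep (resK p σ) g = _ * cIndRep (resK p σ) (β p)
  rw [← map_mul, ← map_mul, β_comm]

/-- The subspace `(T - λ, S - 1) c-Ind_K^G V`. -/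
def heckeIdeal (lam : k) : Submodule k (cInd (K p) (resK p σ)) :=
  LinearMap.range (T σ - lam • LinearMap.id) ⊔ LinearMap.range (S σ - LinearMap.id)

theorem heckeIdeal_le_comap (lam : k) (g : G p) :
    heckeIdeal σ lam ≤ (heckeIdeal σ lam).comap (cIndRep (resK p σ) g) := by
  refine sup_le ?_ ?_
  · rintro _ ⟨f, rfl⟩
    refine Submodule.mem_sup_left ⟨cIndRep (resK p σ) g f, ?_⟩
    have := congr($(T_comm σ g) f)
    simp only [LinearMap.comp_apply] at this
    simp [this]
  · rintro _ ⟨f, rfl⟩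
    refine Submodule.mem_sup_right ⟨cIndRep (resK p σ) g f, ?_⟩
    have := congr($(S_comm σ g) f)
    simp only [LinearMap.comp_apply] at this
    simp [this]

/-- The space `c-Ind_K^G V / (T - λ, S - 1)`. -/
abbrev HeckeQuot (lam : k) : Type _ := cInd (K p) (resK p σ) ⧸ heckeIdeal σ lam

/-- The representation `c-Ind_K^G V / (T - λ, S - 1) ⊗ (η ∘ det)` of `G`, for a character `η` of
`ℚ_p^×`. -/
def twistedQuot (lam : k) (η : ℚ_[p]ˣ →* kˣ) : Representation k (G p) (HeckeQuot σ lam) where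
  toFun g := (η (Matrix.GeneralLinearGroup.det g) : k) •
    (cIndRep (resK p σ)).quotient (heckeIdeal σ lam) (heckeIdeal_le_comap σ lam) g
  map_one' := by rw [map_one, map_one, map_one, Units.val_one, one_smul]
  map_mul' a b := by
    rw [map_mul, map_mul, map_mul, Units.val_mul, smul_mul_smul_comm]

end Hecke

/-! ### The character `ω` -/

section Omega

variable (p : ℕ) [Fact p.Prime]

theorem norm_mul_absValue (x : ℚ_[p]ˣ) : ‖(x : ℚ_[p]) * ((padicNormE (x : ℚ_[p]) : ℚ) : ℚ_[p])‖ ≤ 1 := by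
  obtain ⟨n, hn⟩ := Padic.padicNormE.image (p := p) x.ne_zero
  have hn' : padicNormE (x : ℚ_[p]) = (p : ℚ) ^ (-n) := by
    have h : ((padicNormE (x : ℚ_[p]) : ℚ) : ℝ) = (((p : ℚ) ^ (-n) : ℚ) : ℝ) := hn
    exact Rat.cast_injective h
  have hp : (p : ℝ) ≠ 0 := Nat.cast_ne_zero.2 (Fact.out : p.Prime).ne_zero
  rw [hn', norm_mul, hn]
  push_cast
  rw [Padic.norm_p_zpow, neg_neg, ← zpow_add₀ hp, neg_add_cancel, zpow_zero]

/-- The character `ω : ℚ_p^× → 𝔽_p^×`, `x ↦ x |x| mod p`. -/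
def omega : ℚ_[p]ˣ →* (ZMod p)ˣ :=
  MonoidHom.toHomUnits
    { toFun := fun x => PadicInt.toZMod
        (toInt p ((x : ℚ_[p]) * ((padicNormE (x : ℚ_[p]) : ℚ) : ℚ_[p])) (norm_mul_absValue p x))
      map_one' := by
        rw [← map_one (PadicInt.toZMod (p := p))]; congr 1; refine PadicInt.ext ?_; simp
      map_mul' := fun x y => by
        rw [← map_mul]; congr 1; refine PadicInt.ext ?_
        simp only [coe_toInt, PadicInt.coe_mul, Units.val_mul, map_mul]
        push_cast
        ring }

variable (k : Type*) [Field k] [Algebra (ZMod p) k]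

/-- The character `ω`, with values in `k`. -/
def omegaK : ℚ_[p]ˣ →* kˣ := (Units.map (algebraMap (ZMod p) k).toMonoidHom).comp (omega p)

variable {p k} {V : Type*} [AddCommGroup V] [Module k V]

/-- The representation `π(r, λ, χ) = c-Ind_K^G V / (T - λ, S - 1) ⊗ (χ ω^r) ∘ det` of `G` on
`HeckeQuot σ λ`, for the weight `V = Sym^r (k^2)^∨`. -/
def piRep (σ : Representation k (Gminus p) V) (r : ℕ) (lam : k) (χ : ℚ_[p]ˣ →* kˣ) :
    Representation k (G p) (HeckeQuot σ lam) :=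
  twistedQuot σ lam (χ * omegaK p k ^ r)

end Omega

/-! ### The weights `Sym^r (k^2)^∨` -/

section Weights

variable (p : ℕ) [Fact p.Prime] (k : Type*) [Field k] [Algebra (ZMod p) k] (r : ℕ)

/-- The symmetric power `Sym^r (k^2)`, as the space of homogeneous polynomials of degree `r` in
the standard basis vectors `X 0, X 1` of `k^2`. -/
abbrev SymPow : Type _ := MvPolynomial.homogeneousSubmodule (Fin 2) k r

variable {k}

/-- The vector `v ∈ k^2`, as an element of degree one of the symmetric algebra of `k^2`. -/
def linForm (v : Fin 2 → k) : MvPolynomial (Fin 2) k :=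
  ∑ i, MvPolynomial.C (v i) * MvPolynomial.X i

theorem linForm_isHomogeneous (v : Fin 2 → k) : (linForm v).IsHomogeneous 1 :=
  MvPolynomial.IsHomogeneous.sum _ _ _ fun i _ => by
    simpa using (MvPolynomial.isHomogeneous_C (Fin 2) (v i)).mul (MvPolynomial.isHomogeneous_X k i)

/-- The element `v^r` of `Sym^r (k^2)`, for `v ∈ k^2`. -/
def vecPow (v : Fin 2 → k) : SymPow k r :=
  ⟨linForm v ^ r, by simpa using (linForm_isHomogeneous v).pow r⟩

/-- The action of a matrix on the symmetric algebra of `k^2`. -/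
def symAlgAct (A : Matrix (Fin 2) (Fin 2) k) : MvPolynomial (Fin 2) k →ₐ[k] MvPolynomial (Fin 2) k :=
  MvPolynomial.aeval fun j => linForm (A.col j)

theorem symAlgAct_linForm (A : Matrix (Fin 2) (Fin 2) k) (v : Fin 2 → k) :
    symAlgAct A (linForm v) = linForm (A.mulVec v) := by
  simp [symAlgAct, linForm, Fin.sum_univ_two, Matrix.mulVec, dotProduct, Matrix.col,
    MvPolynomial.algebraMap_eq]
  ring

/-- The representation of the monoid of `2 × 2` matrices on `Sym^r (k^2)`. -/
def symPowMat : Representation k (Matrix (Fin 2) (Fin 2) k) (SymPow k r) where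
  toFun A := (symAlgAct A).toLinearMap.restrict (fun f hf => by
    have h := MvPolynomial.IsHomogeneous.aeval hf (fun j => linForm (A.col j))
      (fun j => linForm_isHomogeneous _)
    rwa [one_mul] at h)
  map_one' := by
    have : symAlgAct (1 : Matrix (Fin 2) (Fin 2) k) = AlgHom.id k _ := by
      ext j : 1
      fin_cases j <;> simp [symAlgAct, linForm, Matrix.col]
    ext1 f
    ext1
    change symAlgAct 1 f.1 = f.1
    rw [this]; rfl
  map_mul' A B := by
    have : symAlgAct (A * B) = (symAlgAct A).comp (symAlgAct B) := by
      ext j : 1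
      have h1 : ∀ C : Matrix (Fin 2) (Fin 2) k,
          symAlgAct C (MvPolynomial.X j) = linForm (C.col j) := fun C => by simp [symAlgAct]
      rw [AlgHom.comp_apply, h1, h1, symAlgAct_linForm]
      rfl
    ext1 f
    ext1
    change symAlgAct (A * B) f.1 = symAlgAct A (symAlgAct B f.1)
    rw [this]; rfl

theorem symPowMat_vecPow (A : Matrix (Fin 2) (Fin 2) k) (v : Fin 2 → k) :
    symPowMat r A (vecPow r v) = vecPow r (A.mulVec v) := by
  ext1
  change symAlgAct A (linForm v ^ r) = linForm (A.mulVec v) ^ r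
  rw [map_pow, symAlgAct_linForm]

variable (k)

/-- Reduction modulo `p` of the entries of a matrix in `G⁺`, with values in `M₂(k)`. -/
def redK : Gplus p →* Matrix (Fin 2) (Fin 2) k :=
  ((algebraMap (ZMod p) k).mapMatrix : _ →+* _).toMonoidHom.comp (red p)

/-- `Sym^r (k^2)` as a representation of `G⁺`, which acts through reduction modulo `p`. -/
def symPow : Representation k (Gplus p) (SymPow k r) := (symPowMat r).comp (redK p k)

/-- The contragredient `Sym^r (k^2)^∨` as a representation of `G⁻`, `(g ℓ)(m) = ℓ (g⁻¹ m)`. -/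
def symDual : Representation k (Gminus p) (Module.Dual k (SymPow k r)) where
  toFun g := Module.Dual.transpose (symPow p k r ⟨(g : G p)⁻¹, g.2⟩)
  map_one' := by
    have : (⟨((1 : Gminus p) : G p)⁻¹, (1 : Gminus p).2⟩ : Gplus p) = 1 := by ext1; simp
    rw [this, map_one]; rfl
  map_mul' a b := by
    have : (⟨((a * b : Gminus p) : G p)⁻¹, (a * b).2⟩ : Gplus p)
        = ⟨(b : G p)⁻¹, b.2⟩ * ⟨(a : G p)⁻¹, a.2⟩ := by ext1; simp
    rw [this, map_mul]; rfl

/-- The trivial representation `k = Sym^0 (k^2)^∨` of `G⁻`. -/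
abbrev triv : Representation k (Gminus p) k := Representation.trivial k (Gminus p) k

end Weights

/-! ### The map `φ` -/

section Phi

variable (p : ℕ) [Fact p.Prime] (k : Type*) [Field k] [Algebra (ZMod p) k]

/-- `c-Ind_I^K k`, as a representation of `K`. -/
abbrev indIK : Representation k (K p) (cInd ((I p).subgroupOf (K p))
    (Representation.trivial k ((I p).subgroupOf (K p)) k)) :=
  cIndRep (Representation.trivial k ((I p).subgroupOf (K p)) k)

variable {p} in
/-- The reduction modulo `p` of the first column `(a, c)` of a matrix in `K`. -/
def firstCol (κ : K p) : Fin 2 → ZMod p := (red p (KtoGplus p κ)).col 0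

variable {p} in
theorem firstCol_mul (κ κ' : K p) :
    firstCol (κ * κ') = (red p (KtoGplus p κ)).mulVec (firstCol κ') := by
  rw [firstCol, map_mul, map_mul]; rfl

variable {p} in
theorem firstCol_ne_zero (κ : K p) : firstCol κ ≠ 0 := by
  intro h
  have h1 := firstCol_mul κ⁻¹ κ
  rw [h, Matrix.mulVec_zero, inv_mul_cancel, firstCol, map_one, map_one] at h1
  simpa using congr_fun h1 0

variable {p} in
theorem mk_firstCol_mul (κ i : K p) (hi : (i : G p) ∈ I p) :
    Projectivization.mk (ZMod p) (firstCol (κ * i)) (firstCol_ne_zero _)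
      = Projectivization.mk (ZMod p) (firstCol κ) (firstCol_ne_zero _) := by
  rw [Projectivization.mk_eq_mk_iff']
  refine ⟨firstCol i 0, ?_⟩
  have h0 : firstCol i 1 = 0 :=
    (conj_α_mem_Gplus_iff p (K_le_Gplus p i.2)).1 (K_le_Gplus p (conj_mem_K_of_mem_I p hi))
  rw [firstCol_mul]
  ext j
  simp only [Matrix.mulVec, dotProduct, Fin.sum_univ_two, h0, mul_zero, add_zero, Pi.smul_apply,
    smul_eq_mul]
  rw [mul_comm]
  rfl

/-- The map `Map(ℙ¹(𝔽_p), k) → c-Ind_I^K k`, sending `f` to the function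
`(a b; c d) ↦ f (a : c)`. -/
def mapToInd : (ℙ (ZMod p) (Fin 2 → ZMod p) → k) →ₗ[k]
    cInd ((I p).subgroupOf (K p)) (Representation.trivial k ((I p).subgroupOf (K p)) k) where
  toFun f := ⟨fun κ => f (Projectivization.mk (ZMod p) (firstCol κ) (firstCol_ne_zero κ)), by
    refine ⟨fun κ i => ?_, Set.toFinite _⟩
    exact congr_arg f (mk_firstCol_mul κ i i.2)⟩
  map_add' _ _ := rfl
  map_smul' _ _ := rfl

/-- The map `Sym^{p-1} (k^2)^∨ → Map(ℙ¹(𝔽_p), k)` sending `ℓ` to `(x : y) ↦ ℓ((x, y)^{p-1})`, that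
is, viewing `ℓ` as a homogeneous polynomial function of degree `p - 1` on `k^2` and restricting
it to `𝔽_p^2`. -/
def symToMap : Module.Dual k (SymPow k (p - 1)) →ₗ[k] (ℙ (ZMod p) (Fin 2 → ZMod p) → k) where
  toFun ℓ P := ℓ (vecPow (p - 1) fun i => algebraMap (ZMod p) k (P.rep i))
  map_add' _ _ := rfl
  map_smul' _ _ := rfl

/-- `symToMap` does not depend on the choice of homogeneous coordinates. -/
theorem symToMap_mk (ℓ : Module.Dual k (SymPow k (p - 1))) (v : Fin 2 → ZMod p) (hv : v ≠ 0) :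
    symToMap p k ℓ (Projectivization.mk (ZMod p) v hv)
      = ℓ (vecPow (p - 1) fun i => algebraMap (ZMod p) k (v i)) := by
  obtain ⟨a, ha⟩ := Projectivization.exists_smul_eq_mk_rep (ZMod p) v hv
  change ℓ _ = ℓ _
  congr 1
  rw [← ha]
  ext1
  change linForm _ ^ _ = linForm _ ^ _
  have : linForm (fun i => algebraMap (ZMod p) k ((a • v) i))
      = MvPolynomial.C (algebraMap (ZMod p) k a) * linForm fun i => algebraMap (ZMod p) k (v i) := by
    simp only [linForm, Finset.mul_sum, ← mul_assoc, ← map_mul]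
    rfl
  rw [this, mul_pow, ← map_pow, ← map_pow, ZMod.pow_card_sub_one_eq_one a.ne_zero, map_one,
    map_one, one_mul]

/-- The inclusion of the trivial representation in `c-Ind_I^K k` as the constant functions. -/
def constToInd : k →ₗ[k]
    cInd ((I p).subgroupOf (K p)) (Representation.trivial k ((I p).subgroupOf (K p)) k) :=
  mapToInd p k ∘ₗ LinearMap.pi fun _ => LinearMap.id

theorem constToInd_equivariant (κ : K p) (a : k) :
    constToInd p k (resK p (triv p k) κ a) = indIK p k κ (constToInd p k a) := rfl

/-- The inclusion of `Sym^{p-1} (k^2)^∨` in `c-Ind_I^K k`. -/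
def symToInd : Module.Dual k (SymPow k (p - 1)) →ₗ[k]
    cInd ((I p).subgroupOf (K p)) (Representation.trivial k ((I p).subgroupOf (K p)) k) :=
  mapToInd p k ∘ₗ symToMap p k

theorem symToInd_equivariant (κ : K p) (ℓ : Module.Dual k (SymPow k (p - 1))) :
    symToInd p k (resK p (symDual p k (p - 1)) κ ℓ) = indIK p k κ (symToInd p k ℓ) := by
  ext x
  change symToMap p k _ _ = symToMap p k _ _
  rw [symToMap_mk, symToMap_mk]
  change ℓ (symPowMat (p - 1) (redK p k (KtoGplus p κ⁻¹)) _) = _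
  rw [symPowMat_vecPow, firstCol_mul]
  congr 2
  ext i
  simp [redK, Matrix.mulVec, dotProduct]

/-- The map `c-Ind_K^G k ⊕ c-Ind_K^G Sym^{p-1} (k^2)^∨ → c-Ind_K^G (c-Ind_I^K k)`. -/
def decomp : cInd (K p) (resK p (triv p k)) × cInd (K p) (resK p (symDual p k (p - 1))) →ₗ[k]
    cInd (K p) (indIK p k) :=
  (cIndMap _ _ (constToInd p k) (constToInd_equivariant p k)).coprod
    (cIndMap _ _ (symToInd p k) (symToInd_equivariant p k))

/-- `c-Ind_I^G k`. -/
abbrev indI : Submodule k (G p → k) := cInd (I p) (Representation.trivial k (I p) k)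

/-- `φ₁ : c-Ind_I^G k → c-Ind_K^G k`, `[g, a] ↦ [g, a]`. -/
def phi1 : indI p k →ₗ[k] cInd (K p) (resK p (triv p k)) :=
  lift _ (fun g => single (resK p (triv p k)) g) (fun g i v =>
    single_mul (resK p (triv p k)) g ⟨i, I_le_K p i.2⟩ v)

/-- `φ₂ : c-Ind_I^G k → c-Ind_K^G k`, `[g, a] ↦ [g α, a]`. -/
def phi2 : indI p k →ₗ[k] cInd (K p) (resK p (triv p k)) :=
  lift _ (fun g => single (resK p (triv p k)) (g * α p)) (fun g i v => by
    have := single_mul (resK p (triv p k)) (g * α p) ⟨_, conj_mem_K_of_mem_I p i.2⟩ v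
    simp only [mul_assoc, mul_inv_cancel_left] at this
    simp only [mul_assoc]
    exact this)

/-- The composite
`c-Ind_K^G k ⊕ c-Ind_K^G Sym^{p-1} (k^2)^∨ → c-Ind_K^G (c-Ind_I^K k) ≃ c-Ind_I^G k
→ c-Ind_K^G k ⊕ c-Ind_K^G k`, whose last arrow is `(φ₁, φ₂)`. -/
def composite :
    cInd (K p) (resK p (triv p k)) × cInd (K p) (resK p (symDual p k (p - 1))) →ₗ[k]
      cInd (K p) (resK p (triv p k)) × cInd (K p) (resK p (triv p k)) :=
  (phi1 p k).prod (phi2 p k) ∘ₗ cIndTrans k (I p) (K p) (I_le_K p) ∘ₗ decomp p k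

/-- `φ : c-Ind_K^G Sym^{p-1} (k^2)^∨ → c-Ind_K^G k`, the lower right entry of `composite`. -/
def phi : cInd (K p) (resK p (symDual p k (p - 1))) →ₗ[k] cInd (K p) (resK p (triv p k)) :=
  LinearMap.snd k _ _ ∘ₗ composite p k ∘ₗ LinearMap.inr k _ _

end Phi

end ModPGL2

end

noncomputable section

namespace ModPGL2

/-! ### The bijection of `K / I` with the projective line -/

section Line

variable (p : ℕ) [Fact p.Prime]

/-! The first column mod `p` identifies `K / I` with `ℙ¹(𝔽_p)`, so `c-Ind_I^K k` becomes the space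
of functions on `ℙ¹(𝔽_p)`. On `[g, F]`, the map `φ₁` gives `[g, ∑ F(P)]`, because the translates
`gκ` lie in one coset of `K`, while `φ₂` gives `∑ [g x α, F(x)]` over `K / I`.

Matrix form: for constant `F` the sum is `(p + 1) a = a` and the second formula is that of `T`. For
`F` coming from `Sym^{p-1}` the sum over `ℙ¹(𝔽_p)` vanishes (`finsum_symToMap`), hence so does the
upper right entry.

Commutation with `T`: the matrix `x α` reduces mod `p` to a matrix of rank one, so `α⁻¹ x⁻¹ ℓ`, as a
function on `ℙ¹(𝔽_p)`, is the constant `ℓ(x)` away from `(0 : 1)` and zero there (`symToMap_αInv`).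
Thus `φ T [g, ℓ]` is `T φ [g, ℓ]` without the backtracking terms. These all equal `[g β, ℓ(x)]`, and
their sum is killed by `∑ ℓ(x) = 0`.

Nonvanishing: the functional `[g, a] ↦ a (v(g₁) - v(g₂))`, with `v` the minimal valuation of a row,
is tested on the image of `φ`. Passing from `g` to `g x α` raises the valuation of a row by one for
exactly one line `x`, the kernel of the reduction of that row divided by its content, and leaves it
unchanged otherwise. Weighted sums over `x` are therefore explicit (`finsum_apartmentPos`): constant
weights show that the functional kills `T - 1`, it visibly kills `S - 1`, and on `φ [1, ℓ]` it takes
the value `ℓ((0,1)^{p-1}) - ℓ((1,0)^{p-1})`, which is nonzero for a suitable `ℓ`. -/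

variable {p} in
/-- The point of `ℙ¹(𝔽_p)` given by the first column of a matrix in `K`. -/
def line (κ : K p) : ℙ (ZMod p) (Fin 2 → ZMod p) :=
  Projectivization.mk (ZMod p) (firstCol κ) (firstCol_ne_zero κ)

theorem toZMod_eq_zero_iff_norm (z : ℤ_[p]) : PadicInt.toZMod z = 0 ↔ ‖z‖ < 1 := by
  rw [← RingHom.mem_ker, PadicInt.ker_toZMod, IsLocalRing.mem_maximalIdeal, PadicInt.mem_nonunits]

theorem isUnit_iff_toZMod_ne_zero (z : ℤ_[p]) : IsUnit z ↔ PadicInt.toZMod z ≠ 0 := by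
  rw [Ne, ← RingHom.mem_ker, PadicInt.ker_toZMod, IsLocalRing.mem_maximalIdeal, mem_nonunits_iff,
    not_not]

/-- The element of `K` given by a matrix over `ℤ_p` with invertible determinant. -/
def ofIntMat (M : Matrix (Fin 2) (Fin 2) ℤ_[p]) (hM : IsUnit M.det) : K p :=
  ⟨Matrix.GeneralLinearGroup.map (algebraMap ℤ_[p] ℚ_[p])
    (Matrix.nonsingInvUnit M hM), ⟨_, rfl⟩⟩

theorem firstCol_ofIntMat (M : Matrix (Fin 2) (Fin 2) ℤ_[p]) (hM : IsUnit M.det) (i : Fin 2) :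
    firstCol (ofIntMat p M hM) i = PadicInt.toZMod (M i 0) := rfl

theorem ofIntMat_apply (M : Matrix (Fin 2) (Fin 2) ℤ_[p]) (hM : IsUnit M.det) (i j : Fin 2) :
    ((ofIntMat p M hM : K p) : G p).1 i j = (M i j : ℚ_[p]) := rfl

/-- A lift of `v` to `ℤ_p` has a unit entry. Taking as second column the basis vector of the other
coordinate makes the determinant that unit up to sign. -/
theorem exists_firstCol_eq (v : Fin 2 → ZMod p) (hv : v ≠ 0) : ∃ κ : K p, firstCol κ = v := by
  obtain ⟨a, ha⟩ := ZMod.ringHom_surjective (PadicInt.toZMod (p := p)) (v 0)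
  obtain ⟨c, hc⟩ := ZMod.ringHom_surjective (PadicInt.toZMod (p := p)) (v 1)
  by_cases h0 : v 0 = 0
  · have h1 : v 1 ≠ 0 := fun h1 => hv (by ext i; fin_cases i <;> assumption)
    have hdet : IsUnit (!![a, 1; c, 0] : Matrix (Fin 2) (Fin 2) ℤ_[p]).det := by
      have := (isUnit_iff_toZMod_ne_zero p c).2 (hc ▸ h1)
      simpa [Matrix.det_fin_two] using this
    refine ⟨ofIntMat p _ hdet, ?_⟩
    ext i
    rw [firstCol_ofIntMat]
    fin_cases i
    · exact ha
    · exact hc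
  · have hdet : IsUnit (!![a, 0; c, 1] : Matrix (Fin 2) (Fin 2) ℤ_[p]).det := by
      have := (isUnit_iff_toZMod_ne_zero p a).2 (ha ▸ h0)
      simpa [Matrix.det_fin_two] using this
    refine ⟨ofIntMat p _ hdet, ?_⟩
    ext i
    rw [firstCol_ofIntMat]
    fin_cases i
    · exact ha
    · exact hc

variable {p}

/-- If the first column of `y` is `c` times that of `x`, then `x⁻¹ y` has first column `(c, 0)` mod
`p`. -/
theorem red_inv_mul_of_line_eq {x y : K p} (h : line x = line y) :
    red p (KtoGplus p (x⁻¹ * y)) 1 0 = 0 := by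
  obtain ⟨c, hc⟩ := (Projectivization.mk_eq_mk_iff' _ _ _ _ _).1 h.symm
  have h1 : firstCol (x⁻¹ * y) = c • firstCol (1 : K p) := by
    rw [firstCol_mul, ← hc, Matrix.mulVec_smul, ← firstCol_mul, inv_mul_cancel]
  have h2 := congr_fun h1 1
  rw [firstCol, firstCol, map_one, map_one] at h2
  simpa using h2

theorem inv_mul_mem_of_line_eq {x y : K p} (h : line x = line y) :
    x⁻¹ * y ∈ (I p).subgroupOf (K p) := by
  rw [Subgroup.mem_subgroupOf]
  have key : ∀ x y : K p, line x = line y →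
      (α p)⁻¹ * ((x⁻¹ * y : K p) : G p) * α p ∈ Gplus p := fun x y h =>
    (conj_α_mem_Gplus_iff p (K_le_Gplus p (x⁻¹ * y).2)).2 (red_inv_mul_of_line_eq h)
  refine ⟨(x⁻¹ * y : K p).2, (α p)⁻¹ * ((x⁻¹ * y : K p) : G p) * α p, ?_, ?_⟩
  · refine (mem_K_iff p _).2 ⟨key _ _ h, ?_⟩
    have := key _ _ h.symm
    simpa [mul_assoc] using this
  · simp [mul_assoc]

theorem line_out (y : K p) : line (y : K p ⧸ (I p).subgroupOf (K p)).out = line y := by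
  have hy : y⁻¹ * (y : K p ⧸ (I p).subgroupOf (K p)).out ∈ (I p).subgroupOf (K p) :=
    QuotientGroup.eq.1 (QuotientGroup.out_eq' _).symm
  have := mk_firstCol_mul y _ (Subgroup.mem_subgroupOf.1 hy)
  simp only [mul_inv_cancel_left] at this
  exact this

theorem exists_line_eq (P : ℙ (ZMod p) (Fin 2 → ZMod p)) : ∃ κ : K p, line κ = P := by
  obtain ⟨κ, hκ⟩ := exists_firstCol_eq p P.rep P.rep_nonzero
  refine ⟨κ, ?_⟩
  rw [line, ← P.mk_rep]
  simp only [hκ, P.mk_rep]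

variable (p) in
/-- The bijection `K / I ≃ ℙ¹(𝔽_p)`, given by the first column. -/
def cosetEquiv : (K p ⧸ (I p).subgroupOf (K p)) ≃ ℙ (ZMod p) (Fin 2 → ZMod p) :=
  Equiv.ofBijective (fun c => line c.out) (by
    constructor
    · intro c d h
      rw [← QuotientGroup.out_eq' c, ← QuotientGroup.out_eq' d, QuotientGroup.eq]
      exact inv_mul_mem_of_line_eq h
    · intro P
      obtain ⟨κ, rfl⟩ := exists_line_eq P
      exact ⟨(κ : K p ⧸ (I p).subgroupOf (K p)), line_out κ⟩)

theorem finsum_line {M : Type*} [AddCommMonoid M] (f : ℙ (ZMod p) (Fin 2 → ZMod p) → M) :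
    ∑ᶠ x : K p ⧸ (I p).subgroupOf (K p), f (line x.out) = ∑ᶠ P, f P :=
  finsum_comp_equiv (cosetEquiv p)

/-! ### Sums over the projective line -/

variable {k : Type*} [Field k] [Algebra (ZMod p) k]

/-- The line has `p + 1` points, and `p + 1 = 1` in `k`. -/
theorem finsum_projectivization_const (a : k) :
    ∑ᶠ _ : ℙ (ZMod p) (Fin 2 → ZMod p), a = a := by
  have : CharP k p := charP_of_injective_algebraMap (algebraMap (ZMod p) k).injective p
  cases nonempty_fintype (ℙ (ZMod p) (Fin 2 → ZMod p))
  rw [finsum_eq_sum_of_fintype, Finset.sum_const, Finset.card_univ, ← Nat.card_eq_fintype_card,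
    Projectivization.card_of_finrank_two _ _ (Module.finrank_fin_fun _), Nat.card_zmod,
    nsmul_eq_mul, Nat.cast_add, CharP.cast_eq_zero, zero_add, Nat.cast_one, one_mul]

/-- In the binomial expansion each term carries `x ^ m * y ^ (p - 1 - m)`, where one exponent is
less than `p - 1`; the power sum over `𝔽_p` with that exponent vanishes. -/
theorem sum_vecPow_eq_zero :
    ∑ v : Fin 2 → ZMod p, vecPow (p - 1) (fun i => algebraMap (ZMod p) k (v i)) = 0 := by
  have hp := (Fact.out : p.Prime).two_le
  have hpow : ∀ i < p - 1, ∑ x : ZMod p, (MvPolynomial.C (algebraMap (ZMod p) k x) :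
      MvPolynomial (Fin 2) k) ^ i = 0 := by
    intro i hi
    simp only [← map_pow, ← map_sum]
    rw [FiniteField.sum_pow_lt_card_sub_one (ZMod p) i (by rwa [ZMod.card]), map_zero, map_zero]
  ext1
  rw [AddSubmonoidClass.coe_finsetSum]
  change ∑ v : Fin 2 → ZMod p, linForm (fun i => algebraMap (ZMod p) k (v i)) ^ (p - 1) = 0
  rw [← Equiv.sum_comp (finTwoArrowEquiv (ZMod p)).symm]
  simp only [linForm, Fin.sum_univ_two, finTwoArrowEquiv_symm_apply, Matrix.cons_val_zero,
    Matrix.cons_val_one, add_pow, mul_pow]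
  rw [Finset.sum_comm]
  refine Finset.sum_eq_zero fun m hm => ?_
  rw [Fintype.sum_prod_type]
  have : ∀ x y : ZMod p,
      (MvPolynomial.C (algebraMap (ZMod p) k x) ^ m * MvPolynomial.X 0 ^ m) *
        (MvPolynomial.C (algebraMap (ZMod p) k y) ^ (p - 1 - m) *
          MvPolynomial.X 1 ^ (p - 1 - m)) * ((p - 1).choose m : MvPolynomial (Fin 2) k) =
      MvPolynomial.C (algebraMap (ZMod p) k x) ^ m *
        (MvPolynomial.C (algebraMap (ZMod p) k y) ^ (p - 1 - m) *
          (MvPolynomial.X 0 ^ m * MvPolynomial.X 1 ^ (p - 1 - m) * ((p - 1).choose m : MvPolynomial (Fin 2) k))) :=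
    fun x y => by ring
  simp only [this, ← Finset.mul_sum, ← Finset.sum_mul]
  -- In the remaining case `m = p - 1` it is the sum over `y`, with exponent `0 < p - 1`, that
  -- vanishes.
  by_cases h : m < p - 1
  · rw [hpow m h, zero_mul]
  · rw [hpow (p - 1 - m) (by omega), zero_mul, mul_zero]

/-- The sum over all of `𝔽_p²` is zero and the origin contributes nothing. Each point of the line is
hit by `p - 1` nonzero vectors with equal values, and `p - 1 = -1` is invertible in `k`. -/
theorem finsum_symToMap (ℓ : Module.Dual k (SymPow k (p - 1))) :
    ∑ᶠ P, symToMap p k ℓ P = 0 := by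
  classical
  have : CharP k p := charP_of_injective_algebraMap (algebraMap (ZMod p) k).injective p
  have hp := (Fact.out : p.Prime).two_le
  cases nonempty_fintype (ℙ (ZMod p) (Fin 2 → ZMod p))
  rw [finsum_eq_sum_of_fintype]
  set F : (Fin 2 → ZMod p) → k := fun v =>
    ℓ (vecPow (p - 1) fun i => algebraMap (ZMod p) k (v i)) with hF
  have h1 : ∑ v, F v = 0 := by
    rw [← map_sum, sum_vecPow_eq_zero, map_zero]
  have h0 : F 0 = 0 := by
    have : vecPow (p - 1) (fun i => algebraMap (ZMod p) k ((0 : Fin 2 → ZMod p) i)) = 0 := by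
      ext1
      change linForm _ ^ (p - 1) = 0
      simp [linForm, show p - 1 ≠ 0 by omega]
    rw [hF]
    dsimp only
    rw [this, map_zero]
  have h2 : ∑ v : {v : Fin 2 → ZMod p // v ≠ 0}, F v = 0 := by
    rw [← Fintype.sum_subtype_add_sum_subtype (· = 0) F] at h1
    rw [← h1, right_eq_add]
    exact Finset.sum_eq_zero fun v _ => by rw [v.2, h0]
  have h3 : ∀ v : {v : Fin 2 → ZMod p // v ≠ 0}, F v =
      symToMap p k ℓ
        (Projectivization.nonZeroEquivProjectivizationProdUnits (ZMod p) (Fin 2 → ZMod p) v).1 :=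
    fun v => (symToMap_mk p k ℓ v.1 v.2).symm
  rw [Finset.sum_congr rfl fun v _ => h3 v,
    Equiv.sum_comp (Projectivization.nonZeroEquivProjectivizationProdUnits (ZMod p)
      (Fin 2 → ZMod p)) (fun Q => symToMap p k ℓ Q.1), Fintype.sum_prod_type] at h2
  simp only [Finset.sum_const, Finset.card_univ, ZMod.card_units, ← Finset.smul_sum] at h2
  rw [nsmul_eq_mul, Nat.cast_sub (by omega), CharP.cast_eq_zero] at h2
  simpa using h2

/-- Summing over the cosets on whose first column a nonzero linear form vanishes. -/
theorem finsum_ite_eq_zero {M : Type*} [AddCommMonoid M] (w : Fin 2 → ZMod p) (hw : w ≠ 0)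
    (f : K p ⧸ (I p).subgroupOf (K p) → M) (κ : K p) (hwv : w ⬝ᵥ firstCol κ = 0) :
    ∑ᶠ c : K p ⧸ (I p).subgroupOf (K p), (if w ⬝ᵥ firstCol c.out = 0 then f c else 0) =
      f κ := by
  -- The kernel of a nonzero linear form on a plane is a single line; concretely, two vectors in it
  -- have determinant zero (`hdet`) and are proportional.
  have hline : ∀ x : K p, w ⬝ᵥ firstCol x = 0 ↔ line x = line κ := by
    intro x
    rw [line, line, Projectivization.mk_eq_mk_iff']
    constructor
    · intro h
      have hx := firstCol_ne_zero x
      have hκ := firstCol_ne_zero κ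
      simp only [dotProduct, Fin.sum_univ_two] at h hwv
      have hdet : firstCol x 0 * firstCol κ 1 = firstCol x 1 * firstCol κ 0 := by
        by_cases h0 : w 0 = 0
        · have h1 : w 1 ≠ 0 := fun h1 => hw (by ext i; fin_cases i <;> assumption)
          have hx1 : firstCol x 1 = 0 := by simpa [h0, h1] using h
          have hκ1 : firstCol κ 1 = 0 := by simpa [h0, h1] using hwv
          rw [hx1, hκ1]; ring
        · apply mul_left_cancel₀ h0
          linear_combination firstCol κ 1 * h - firstCol x 1 * hwv
      by_cases h0 : firstCol κ 0 = 0
      · have h1 : firstCol κ 1 ≠ 0 := fun h1 => hκ (by ext i; fin_cases i <;> assumption)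
        refine ⟨firstCol x 1 / firstCol κ 1, ?_⟩
        have hx0 : firstCol x 0 = 0 := by simpa [h0, h1] using hdet
        ext i
        fin_cases i <;> simp [h0, hx0, h1]
      · refine ⟨firstCol x 0 / firstCol κ 0, ?_⟩
        ext i
        fin_cases i
        · simp [h0]
        · simp only [Pi.smul_apply, smul_eq_mul, Fin.mk_one, Fin.isValue]
          field_simp
          linear_combination hdet
    · rintro ⟨c, hc⟩
      rw [← hc, dotProduct_smul, hwv, smul_zero]
  have hcoset : ∀ c : K p ⧸ (I p).subgroupOf (K p),
      w ⬝ᵥ firstCol c.out = 0 ↔ c = (κ : K p ⧸ (I p).subgroupOf (K p)) := by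
    intro c
    rw [hline, ← line_out κ]
    exact (cosetEquiv p).injective.eq_iff (a := c)
  rw [finsum_eq_single _ (κ : K p ⧸ (I p).subgroupOf (K p))]
  · rw [if_pos ((hcoset _).2 rfl)]
  · intro c hc
    rw [if_neg (mt (hcoset c).1 hc)]

end Line

/-! ### Equivariance of `φ` -/

section PhiFormulas

variable {p : ℕ} [Fact p.Prime] {k : Type*} [Field k]

theorem cIndTrans_single_mapToInd (g : G p) (F : ℙ (ZMod p) (Fin 2 → ZMod p) → k) :
    cIndTrans k (I p) (K p) (I_le_K p) (single (indIK p k) g (mapToInd p k F)) =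
      ∑ᶠ x : K p ⧸ (I p).subgroupOf (K p),
        single (Representation.trivial k (I p) k) (g * x.out) (F (line x.out)) := by
  rw [cIndTrans, lift_single]
  rfl

theorem single_mul_K (g : G p) (κ : K p) (a : k) :
    single (resK p (triv p k)) (g * κ) a = single (resK p (triv p k)) g a :=
  single_mul (resK p (triv p k)) g κ a

theorem phi1_single (g : G p) (a : k) :
    phi1 p k (single (Representation.trivial k (I p) k) g a) =
      single (resK p (triv p k)) g a :=
  lift_single _ _ _ g a

/-- All `g κ` with `κ ∈ K` define the same coset and `K` acts trivially, so only the total of the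
values survives. -/
theorem phi1_mapToInd (g : G p) (F : ℙ (ZMod p) (Fin 2 → ZMod p) → k) :
    phi1 p k (cIndTrans k (I p) (K p) (I_le_K p) (single (indIK p k) g (mapToInd p k F))) =
      single (resK p (triv p k)) g (∑ᶠ P, F P) := by
  rw [cIndTrans_single_mapToInd, ← finsum_line]
  cases nonempty_fintype (K p ⧸ (I p).subgroupOf (K p))
  simp only [finsum_eq_sum_of_fintype, map_sum, phi1_single, single_mul_K]

theorem phi2_mapToInd (g : G p) (F : ℙ (ZMod p) (Fin 2 → ZMod p) → k) :
    phi2 p k (cIndTrans k (I p) (K p) (I_le_K p) (single (indIK p k) g (mapToInd p k F))) =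
      ∑ᶠ x : K p ⧸ (I p).subgroupOf (K p),
        single (resK p (triv p k)) (g * x.out * α p) (F (line x.out)) := by
  rw [cIndTrans_single_mapToInd]
  cases nonempty_fintype (K p ⧸ (I p).subgroupOf (K p))
  simp only [finsum_eq_sum_of_fintype, map_sum, phi2, lift_single]

theorem heckeTerm_triv (g : G p) (x : K p) (a : k) :
    heckeTerm (triv p k) g x a = single (resK p (triv p k)) (g * x * α p) a := rfl

variable (p) in
theorem isUnit_det_swap : IsUnit (!![0, 1; 1, 0] : Matrix (Fin 2) (Fin 2) ℤ_[p]).det := by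
  simp [Matrix.det_fin_two]

variable (p) in
/-- The permutation matrix `(0 1; 1 0)`. -/
def swapK : K p := ofIntMat p !![0, 1; 1, 0] (isUnit_det_swap p)

/-- This is backtracking on the tree: following `α` by the step through the swap returns to the
starting vertex, up to the centre. -/
theorem α_mul_swapK_mul_α : α p * swapK p * α p = β p * swapK p := by
  have h1 : ((swapK p : K p) : G p).1 = !![0, 1; 1, 0] := by
    ext i j
    rw [swapK, ofIntMat_apply]
    fin_cases i <;> fin_cases j <;> simp
  have h2 : (β p).1 = !![(p : ℚ_[p]), 0; 0, (p : ℚ_[p])] := rfl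
  apply Units.ext
  rw [Units.val_mul, Units.val_mul, Units.val_mul, h1, h2, α_val]
  ext i j
  fin_cases i <;> fin_cases j <;> simp

/-- Only the coset of the swap has first column `(0 : 1)`. Its term is `[g β, a]`, which does not
depend on `x`. -/
theorem finsum_heckeTerm_ite (g : G p) (x : K p) (a : k) :
    ∑ᶠ y : K p ⧸ (I p).subgroupOf (K p),
      heckeTerm (triv p k) (g * x * α p) y.out (if firstCol y.out 0 = 0 then 0 else a) =
    ∑ᶠ y : K p ⧸ (I p).subgroupOf (K p), heckeTerm (triv p k) (g * x * α p) y.out a -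
      single (resK p (triv p k)) (g * β p) a := by
  have h := finsum_ite_eq_zero (![1, 0] : Fin 2 → ZMod p) (by simp)
    (fun y => heckeTerm (triv p k) (g * x * α p) y.out a) (swapK p) (by
      simp [swapK, firstCol_ofIntMat, dotProduct])
  have hs : g * x * α p * swapK p * α p = g * β p * ((x * swapK p : K p) : G p) := by
    rw [mul_assoc _ (α p), mul_assoc _ _ (α p), α_mul_swapK_mul_α, Subgroup.coe_mul, ← mul_assoc,
      mul_assoc g, ← β_comm, mul_assoc, mul_assoc, mul_assoc]
  rw [heckeTerm_out, heckeTerm_triv, hs, single_mul_K] at h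
  rw [← h]
  cases nonempty_fintype (K p ⧸ (I p).subgroupOf (K p))
  rw [finsum_eq_sum_of_fintype, finsum_eq_sum_of_fintype, finsum_eq_sum_of_fintype,
    ← Finset.sum_sub_distrib]
  refine Finset.sum_congr rfl fun y _ => ?_
  have hy : (![1, 0] : Fin 2 → ZMod p) ⬝ᵥ firstCol y.out = firstCol y.out 0 := by
    simp [dotProduct]
  rw [hy]
  split_ifs <;> simp

/-! ### The composite as a lower triangular matrix -/

variable [Algebra (ZMod p) k]

theorem phi_single (g : G p) (ℓ : Module.Dual k (SymPow k (p - 1))) :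
    phi p k (single (resK p (symDual p k (p - 1))) g ℓ) =
      ∑ᶠ x : K p ⧸ (I p).subgroupOf (K p),
        single (resK p (triv p k)) (g * x.out * α p) (symToMap p k ℓ (line x.out)) := by
  rw [← phi2_mapToInd]
  simp [phi, composite, decomp, cIndMap, lift_single, symToInd]

theorem composite_inl (x : cInd (K p) (resK p (triv p k))) :
    composite p k (x, 0) = (x, T (triv p k) x) := by
  have : composite p k ∘ₗ LinearMap.inl k _ _ = LinearMap.prod LinearMap.id (T (triv p k)) := by
    apply cInd_ext
    intro g a
    have hd : decomp p k (single (resK p (triv p k)) g a, 0) =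
        single (indIK p k) g (mapToInd p k fun _ => a) := by
      simp [decomp, cIndMap, lift_single]; rfl
    simp only [composite, LinearMap.comp_apply, LinearMap.inl_apply, LinearMap.prod_apply,
      Function.prod, hd, phi1_mapToInd, phi2_mapToInd, finsum_projectivization_const, T_single]
    rfl
  exact congr($this x)

theorem fst_composite_inr (y : cInd (K p) (resK p (symDual p k (p - 1)))) :
    (composite p k (0, y)).1 = 0 := by
  have : LinearMap.fst k _ _ ∘ₗ composite p k ∘ₗ LinearMap.inr k _ _ = 0 := by
    apply cInd_ext
    intro g ℓ
    have hd : decomp p k (0, single (resK p (symDual p k (p - 1))) g ℓ) =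
        single (indIK p k) g (mapToInd p k (symToMap p k ℓ)) := by
      simp [decomp, cIndMap, lift_single, symToInd]
    simp only [composite, LinearMap.comp_apply, LinearMap.inr_apply, LinearMap.prod_apply,
      Function.prod, hd, phi1_mapToInd, finsum_symToMap, LinearMap.fst_apply, map_zero,
      LinearMap.zero_apply]
  exact congr($this y)

theorem composite_apply (x : cInd (K p) (resK p (triv p k)))
    (y : cInd (K p) (resK p (symDual p k (p - 1)))) :
    composite p k (x, y) = (x, T (triv p k) x + phi p k y) := by
  have h : ((x, y) : _ × _) = (x, 0) + (0, y) := by simp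
  rw [h, map_add, composite_inl]
  -- The second coordinate is the definition of `phi`; only the first needs the vanishing of the
  -- upper right entry.
  refine Prod.ext ?_ rfl
  rw [Prod.fst_add, fst_composite_inr, add_zero]

theorem phi_cIndRep (g : G p) (y : cInd (K p) (resK p (symDual p k (p - 1)))) :
    phi p k (cIndRep _ g y) = cIndRep _ g (phi p k y) := by
  have : phi p k ∘ₗ cIndRep _ g = cIndRep _ g ∘ₗ phi p k := by
    apply cInd_ext
    intro g' ℓ
    rw [LinearMap.comp_apply, LinearMap.comp_apply, cIndRep_single, phi_single, phi_single]
    cases nonempty_fintype (K p ⧸ (I p).subgroupOf (K p))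
    rw [finsum_eq_sum_of_fintype, finsum_eq_sum_of_fintype, map_sum]
    simp only [cIndRep_single, mul_assoc]
  exact congr($this y)

/-! ### Commutation of `φ` with `T` -/

theorem vecPow_smul (r : ℕ) (c : k) (v : Fin 2 → k) :
    vecPow r (c • v) = c ^ r • vecPow r v := by
  ext1
  change linForm (c • v) ^ r = c ^ r • linForm v ^ r
  have : linForm (c • v) = c • linForm v := by
    simp [linForm, MvPolynomial.smul_eq_C_mul, mul_assoc]
  rw [this, smul_pow]

/-- Modulo `p`, `α` is the projection `diag(1, 0)`, so `x α` sends every vector to a multiple of the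
first column of `x`. -/
theorem redK_mul_α_mulVec (x : K p) (v : Fin 2 → ZMod p) :
    (redK p k (KtoGplus p x * ⟨α p, α_mem_Gplus p⟩)).mulVec (fun i => algebraMap (ZMod p) k (v i)) =
      algebraMap (ZMod p) k (v 0) • fun i => algebraMap (ZMod p) k (firstCol x i) := by
  have h0 : red p ⟨α p, α_mem_Gplus p⟩ = !![1, 0; 0, 0] := by
    ext i j
    have h : red p ⟨α p, α_mem_Gplus p⟩ i j = PadicInt.toZMod (toInt p _ (α_mem_Gplus p i j)) := rfl
    rw [h]
    have h1 : ∀ h, toInt p 1 h = 1 := fun h => rfl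
    have h2 : ∀ h, toInt p 0 h = 0 := fun h => rfl
    have h3 : ∀ h, toInt p (p : ℚ_[p]) h = (p : ℤ_[p]) := fun h => PadicInt.ext (by simp)
    fin_cases i <;> fin_cases j <;> simp [α_val, h1, h2, h3]
  have h : redK p k (KtoGplus p x * ⟨α p, α_mem_Gplus p⟩) =
      (red p (KtoGplus p x) * !![1, 0; 0, 0]).map (algebraMap (ZMod p) k) := by
    rw [← h0, ← map_mul]; rfl
  rw [h]
  ext i
  simp [Matrix.mulVec, dotProduct, Fin.sum_univ_two, Matrix.mul_apply, firstCol, mul_comm]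

/-- By homogeneity the value is `c ^ (p - 1) * ℓ(x)`, with `c` the first coordinate of `y`. The
power is `1` for `c ≠ 0` and `0` for `c = 0`, as `p - 1 > 0`. -/
theorem symToMap_αInv (x y : K p) (ℓ : Module.Dual k (SymPow k (p - 1))) :
    symToMap p k (symDual p k (p - 1) (αInv p x) ℓ) (line y) =
      if firstCol y 0 = 0 then 0 else symToMap p k ℓ (line x) := by
  rw [line, line, symToMap_mk, symToMap_mk]
  have h : (⟨((αInv p x : Gminus p) : G p)⁻¹, (αInv p x).2⟩ : Gplus p) =
      KtoGplus p x * ⟨α p, α_mem_Gplus p⟩ := by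
    ext1
    change ((α p)⁻¹ * (x : G p)⁻¹)⁻¹ = (x : G p) * α p
    simp
  change ℓ (symPowMat (p - 1) (redK p k ⟨((αInv p x : Gminus p) : G p)⁻¹, (αInv p x).2⟩) _) = _
  have hp := (Fact.out : p.Prime).two_le
  rw [h, symPowMat_vecPow, redK_mul_α_mulVec, vecPow_smul, ← map_pow, map_smul]
  split_ifs with h0
  · rw [h0, zero_pow (by omega), map_zero, zero_smul]
  · rw [ZMod.pow_card_sub_one_eq_one h0, map_one, one_smul]

theorem phi_T (y : cInd (K p) (resK p (symDual p k (p - 1)))) :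
    phi p k (T (symDual p k (p - 1)) y) = T (triv p k) (phi p k y) := by
  have : phi p k ∘ₗ T (symDual p k (p - 1)) = T (triv p k) ∘ₗ phi p k := by
    apply cInd_ext
    intro g ℓ
    have hsum := finsum_symToMap (p := p) ℓ
    rw [← finsum_line] at hsum
    have h1 := fun x : K p ⧸ (I p).subgroupOf (K p) =>
      finsum_heckeTerm_ite g x.out (symToMap p k ℓ (line x.out))
    rw [LinearMap.comp_apply, LinearMap.comp_apply, phi_single, T_single]
    cases nonempty_fintype (K p ⧸ (I p).subgroupOf (K p))
    simp only [finsum_eq_sum_of_fintype, map_sum, phi_single, T_single, symToMap_αInv] at hsum h1 ⊢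
    refine (Finset.sum_congr rfl fun x _ => h1 x).trans ?_
    -- The backtracking terms `[g β, ℓ(x)]` share the same group element, so they add up to `[g β, ∑
    -- ℓ(x)] = 0`.
    rw [Finset.sum_sub_distrib, ← map_sum, hsum, map_zero, sub_zero]
    rfl
  exact congr($this y)

end PhiFormulas

/-! ### An eigenfunctional of the Hecke operator -/

section RowVal

variable {p : ℕ} [Fact p.Prime]

variable (p) in
/-- The minimum of the valuations of the entries of a nonzero vector. -/
def rowVal (v : Fin 2 → ℚ_[p]) : ℤ := -Int.log p ‖v‖

/-- A vector over `ℤ_p` is primitive if it does not vanish modulo `p`. -/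
def IsPrimitive (w : Fin 2 → ℤ_[p]) : Prop := (fun i => PadicInt.toZMod (w i)) ≠ 0

theorem rowVal_of_isPrimitive {w : Fin 2 → ℤ_[p]} (hw : IsPrimitive w) (n : ℤ) :
    rowVal p ((p : ℚ_[p]) ^ n • fun i => (w i : ℚ_[p])) = n := by
  have h1 : ‖(fun i => (w i : ℚ_[p]))‖ = 1 := by
    refine le_antisymm ((pi_norm_le_iff_of_nonneg zero_le_one).2 fun i => (w i).2) ?_
    obtain ⟨i, hi⟩ := Function.ne_iff.1 hw
    have h : (1 : ℝ) ≤ ‖w i‖ := not_lt.1 (mt (toZMod_eq_zero_iff_norm p (w i)).2 hi)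
    exact h.trans (norm_le_pi_norm (fun i => (w i : ℚ_[p])) i)
  rw [rowVal, norm_smul, h1, mul_one, Padic.norm_p_zpow,
    Int.log_zpow (Fact.out : p.Prime).one_lt, neg_neg]

/-- Dividing by the power of `p` in an entry of largest norm makes that entry a unit and keeps the
others integral. -/
theorem exists_isPrimitive {v : Fin 2 → ℚ_[p]} (hv : v ≠ 0) :
    ∃ (n : ℤ) (w : Fin 2 → ℤ_[p]), IsPrimitive w ∧
      v = (p : ℚ_[p]) ^ n • fun i => (w i : ℚ_[p]) := by
  have hp := p_ne_zero p
  obtain ⟨i, hi⟩ := Finite.exists_max fun i => ‖v i‖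
  have hvi : v i ≠ 0 := fun h => hv <| by
    ext j
    have := hi j
    rw [h, norm_zero] at this
    simpa using this
  have hn : ‖(p : ℚ_[p]) ^ (v i).valuation‖ = ‖v i‖ := by
    rw [Padic.norm_p_zpow, Padic.norm_eq_zpow_neg_valuation hvi]
  have hle : ∀ j, ‖v j / (p : ℚ_[p]) ^ (v i).valuation‖ ≤ 1 := fun j => by
    rw [norm_div, hn]
    exact div_le_one_of_le₀ (hi j) (norm_nonneg _)
  refine ⟨(v i).valuation, fun j => toInt p _ (hle j), fun h => ?_, ?_⟩
  · have h1 := (toZMod_eq_zero_iff_norm p _).1 (congr_fun h i)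
    rw [PadicInt.norm_def, coe_toInt, norm_div, hn, div_self (norm_ne_zero_iff.2 hvi)] at h1
    exact lt_irrefl _ h1
  · ext j
    simp only [Pi.smul_apply, coe_toInt, smul_eq_mul]
    exact (mul_div_cancel₀ _ (zpow_ne_zero _ hp)).symm

theorem rowVal_smul {v : Fin 2 → ℚ_[p]} (hv : v ≠ 0) :
    rowVal p ((p : ℚ_[p]) • v) = rowVal p v + 1 := by
  obtain ⟨n, w, hw, rfl⟩ := exists_isPrimitive hv
  rw [rowVal_of_isPrimitive hw, smul_smul, ← zpow_one_add₀ (p_ne_zero p),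
    rowVal_of_isPrimitive hw, add_comm]

/-- The row vector `w x`, for `x ∈ K`. -/
def vecMulK (w : Fin 2 → ℤ_[p]) (x : K p) : Fin 2 → ℤ_[p] :=
  Matrix.vecMul w (intMat p (KtoGplus p x))

theorem coe_vecMulK (w : Fin 2 → ℤ_[p]) (x : K p) :
    (fun i => (vecMulK w x i : ℚ_[p])) = Matrix.vecMul (fun i => (w i : ℚ_[p])) (x : G p).1 := by
  ext i
  simp only [vecMulK, Matrix.vecMul, dotProduct, Fin.sum_univ_two, PadicInt.coe_add,
    PadicInt.coe_mul]
  rfl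

theorem toZMod_vecMulK (w : Fin 2 → ℤ_[p]) (x : K p) :
    (fun i => PadicInt.toZMod (vecMulK w x i)) =
      Matrix.vecMul (fun i => PadicInt.toZMod (w i)) (red p (KtoGplus p x)) := by
  ext i
  simp only [vecMulK, Matrix.vecMul, dotProduct, Fin.sum_univ_two, map_add, map_mul]
  rfl

theorem IsPrimitive.vecMulK {w : Fin 2 → ℤ_[p]} (hw : IsPrimitive w) (x : K p) :
    IsPrimitive (vecMulK w x) := by
  intro h
  rw [toZMod_vecMulK] at h
  apply hw
  have := congr_arg (fun v => Matrix.vecMul v (red p (KtoGplus p x⁻¹))) h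
  simpa [Matrix.vecMul_vecMul, ← map_mul] using this

theorem rowVal_vecMul {v : Fin 2 → ℚ_[p]} (hv : v ≠ 0) (x : K p) :
    rowVal p (Matrix.vecMul v (x : G p).1) = rowVal p v := by
  obtain ⟨n, w, hw, rfl⟩ := exists_isPrimitive hv
  rw [Matrix.smul_vecMul, ← coe_vecMulK, rowVal_of_isPrimitive hw,
    rowVal_of_isPrimitive (hw.vecMulK x)]

theorem vecMul_α (v : Fin 2 → ℚ_[p]) : Matrix.vecMul v (α p).1 = ![v 0, p * v 1] := by
  ext i
  rw [α_val]
  fin_cases i <;> simp [Matrix.vecMul, dotProduct, mul_comm]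

/-- Right multiplication by `α` turns the primitive row `u = w x` into `(u₀, p u₁)`. This is
divisible by `p` exactly when `u₀` is, and `u₀` reduces to the pairing of `w` with the first column
of `x`. -/
theorem rowVal_vecMul_mul_α {w : Fin 2 → ℤ_[p]} (hw : IsPrimitive w) (n : ℤ) (x : K p) :
    rowVal p (Matrix.vecMul ((p : ℚ_[p]) ^ n • fun i => (w i : ℚ_[p])) ((x : G p) * α p).1) =
      n + if (fun i => PadicInt.toZMod (w i)) ⬝ᵥ firstCol x = 0 then 1 else 0 := by
  have hu := hw.vecMulK x
  have h0 : PadicInt.toZMod (vecMulK w x 0) =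
      (fun i => PadicInt.toZMod (w i)) ⬝ᵥ firstCol x :=
    congr_fun (toZMod_vecMulK w x) 0
  rw [Units.val_mul, ← Matrix.vecMul_vecMul, Matrix.smul_vecMul, ← coe_vecMulK,
    Matrix.smul_vecMul, vecMul_α, ← h0]
  set u := ModPGL2.vecMulK w x
  split_ifs with h
  · have hdvd := h
    rw [← RingHom.mem_ker, PadicInt.ker_toZMod, PadicInt.maximalIdeal_eq_span_p,
      Ideal.mem_span_singleton] at hdvd
    obtain ⟨z, hz⟩ := hdvd
    -- Here `u₀ = p z`, so `(u₀, p u₁) = p (z, u₁)`. No further `p` splits off: `u₁` is a unit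
    -- because `u` is primitive and `u₀` vanishes mod `p`.
    have hz1 : IsPrimitive ![z, u 1] := by
      intro hz1
      refine hu (funext fun i => ?_)
      fin_cases i
      · exact h
      · exact congr_fun hz1 1
    have he : (![(u 0 : ℚ_[p]), p * (u 1 : ℚ_[p])] : Fin 2 → ℚ_[p]) =
        (p : ℚ_[p]) • fun i => ((![z, u 1] : Fin 2 → ℤ_[p]) i : ℚ_[p]) := by
      ext i
      fin_cases i <;> simp [hz]
    rw [he, smul_smul, ← zpow_add_one₀ (p_ne_zero p), rowVal_of_isPrimitive hz1]
  · have hz1 : IsPrimitive ![u 0, p * u 1] := fun hz1 => h (congr_fun hz1 0)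
    have he : (![(u 0 : ℚ_[p]), p * (u 1 : ℚ_[p])] : Fin 2 → ℚ_[p]) =
        fun i => ((![u 0, p * u 1] : Fin 2 → ℤ_[p]) i : ℚ_[p]) := by
      ext i
      fin_cases i <;> simp
    rw [he, rowVal_of_isPrimitive hz1, add_zero]

end RowVal

/-! ### The difference of the row valuations as a functional -/

section Functional

variable {p : ℕ} [Fact p.Prime]

theorem row_ne_zero (g : G p) (i : Fin 2) : g.1 i ≠ 0 := by
  intro h
  have h1 : (g.1 * (g⁻¹).1) i i = 1 := by
    rw [← Units.val_mul, mul_inv_cancel, Units.val_one, Matrix.one_apply_eq]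
  rw [Matrix.mul_apply_eq_vecMul, h, Matrix.zero_vecMul] at h1
  exact zero_ne_one h1

/-- The position on the standard apartment of the projection of the vertex `g ℤ_p^2` of the tree:
the difference of the valuations of the rows of `g`. -/
def apartmentPos (g : G p) : ℤ := rowVal p (g.1 0) - rowVal p (g.1 1)

theorem apartmentPos_mul_K (g : G p) (κ : K p) : apartmentPos (g * (κ : G p)) = apartmentPos g := by
  simp only [apartmentPos, Units.val_mul, Matrix.mul_apply_eq_vecMul]
  rw [rowVal_vecMul (row_ne_zero g 0), rowVal_vecMul (row_ne_zero g 1)]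

/-- Scaling by `p` raises both row valuations by one, which cancels in the difference; this is why
the functional kills `S - 1`. -/
theorem apartmentPos_β_mul (g : G p) : apartmentPos (β p * g) = apartmentPos g := by
  have h : ∀ i, (β p * g).1 i = (p : ℚ_[p]) • g.1 i := by
    intro i
    have hβ : (β p).1 = !![(p : ℚ_[p]), 0; 0, (p : ℚ_[p])] := rfl
    ext j
    rw [Units.val_mul, hβ, Matrix.mul_apply]
    fin_cases i <;> simp
  rw [apartmentPos, h, h, rowVal_smul (row_ne_zero g 0), rowVal_smul (row_ne_zero g 1),
    apartmentPos]
  ring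

variable (k : Type*) [Field k]

variable (p) in
/-- The functional `[g, a] ↦ a (v(g₁) - v(g₂))` on `c-Ind_K^G k`, where `g₁`, `g₂` are the rows
of `g`. -/
def posFunctional : cInd (K p) (resK p (triv p k)) →ₗ[k] k :=
  lift _ (fun g => (apartmentPos g : k) • LinearMap.id) (fun g κ a => by
    rw [apartmentPos_mul_K]; rfl)

theorem posFunctional_single (g : G p) (a : k) :
    posFunctional p k (single (resK p (triv p k)) g a) = apartmentPos g * a :=
  lift_single _ _ _ g a

variable {k}

/-- By `rowVal_vecMul_mul_α` the position changes by `+1` on the line killed by `w₀` and by `-1` on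
the line killed by `w₁`, the two cancelling if the lines agree. The weight `f` therefore enters only
through its total and its values at these two points. -/
theorem finsum_apartmentPos (g : G p) {n₀ n₁ : ℤ} {w₀ w₁ : Fin 2 → ℤ_[p]} (h₀ : IsPrimitive w₀)
    (h₁ : IsPrimitive w₁) (hg₀ : g.1 0 = (p : ℚ_[p]) ^ n₀ • fun i => (w₀ i : ℚ_[p]))
    (hg₁ : g.1 1 = (p : ℚ_[p]) ^ n₁ • fun i => (w₁ i : ℚ_[p])) {κ₀ κ₁ : K p}
    (hκ₀ : (fun i => PadicInt.toZMod (w₀ i)) ⬝ᵥ firstCol κ₀ = 0)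
    (hκ₁ : (fun i => PadicInt.toZMod (w₁ i)) ⬝ᵥ firstCol κ₁ = 0)
    (f : ℙ (ZMod p) (Fin 2 → ZMod p) → k) :
    ∑ᶠ x : K p ⧸ (I p).subgroupOf (K p), apartmentPos (g * (x.out : G p) * α p) * f (line x.out) =
      apartmentPos g * ∑ᶠ P, f P + (f (line κ₀) - f (line κ₁)) := by
  have e₀ := finsum_ite_eq_zero _ h₀ (fun x => f (line x.out)) κ₀ hκ₀
  have e₁ := finsum_ite_eq_zero _ h₁ (fun x => f (line x.out)) κ₁ hκ₁
  rw [line_out] at e₀ e₁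
  rw [← e₀, ← e₁, ← finsum_line]
  cases nonempty_fintype (K p ⧸ (I p).subgroupOf (K p))
  simp only [finsum_eq_sum_of_fintype]
  rw [Finset.mul_sum, ← Finset.sum_sub_distrib, ← Finset.sum_add_distrib]
  refine Finset.sum_congr rfl fun x _ => ?_
  have hpos : apartmentPos g = n₀ - n₁ := by
    rw [apartmentPos, hg₀, hg₁, rowVal_of_isPrimitive h₀, rowVal_of_isPrimitive h₁]
  rw [hpos, mul_assoc g, apartmentPos, Units.val_mul g, Matrix.mul_apply_eq_vecMul,
    Matrix.mul_apply_eq_vecMul, hg₀, hg₁, rowVal_vecMul_mul_α h₀, rowVal_vecMul_mul_α h₁]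
  push_cast
  split_ifs <;> ring

theorem exists_dotProduct_firstCol_eq_zero (w : Fin 2 → ZMod p) (hw : w ≠ 0) :
    ∃ κ : K p, w ⬝ᵥ firstCol κ = 0 := by
  obtain ⟨κ, hκ⟩ := exists_firstCol_eq p ![-w 1, w 0] (by
    intro h
    apply hw
    have h0 := congr_fun h 0
    have h1 := congr_fun h 1
    ext i
    fin_cases i
    · simpa using h1
    · simpa using h0)
  refine ⟨κ, ?_⟩
  rw [hκ]
  simp [dotProduct, Fin.sum_univ_two]
  ring

theorem posFunctional_S (x : cInd (K p) (resK p (triv p k))) :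
    posFunctional p k (S (triv p k) x) = posFunctional p k x := by
  have : posFunctional p k ∘ₗ S (triv p k) = posFunctional p k := by
    apply cInd_ext
    intro g a
    rw [LinearMap.comp_apply, S, cIndRep_single, posFunctional_single, posFunctional_single,
      apartmentPos_β_mul]
  exact congr($this x)

variable [Algebra (ZMod p) k]

/-- With constant weight the two corrections cancel, and the total over `ℙ¹(𝔽_p)` is `a` because `p
+ 1 = 1` in `k`; hence the eigenvalue `1`. -/
theorem posFunctional_T (x : cInd (K p) (resK p (triv p k))) :
    posFunctional p k (T (triv p k) x) = posFunctional p k x := by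
  have : posFunctional p k ∘ₗ T (triv p k) = posFunctional p k := by
    apply cInd_ext
    intro g a
    obtain ⟨n₀, w₀, h₀, hg₀⟩ := exists_isPrimitive (row_ne_zero g 0)
    obtain ⟨n₁, w₁, h₁, hg₁⟩ := exists_isPrimitive (row_ne_zero g 1)
    obtain ⟨κ₀, hκ₀⟩ := exists_dotProduct_firstCol_eq_zero _ h₀
    obtain ⟨κ₁, hκ₁⟩ := exists_dotProduct_firstCol_eq_zero _ h₁
    have h := finsum_apartmentPos g h₀ h₁ hg₀ hg₁ hκ₀ hκ₁ fun _ => a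
    rw [finsum_projectivization_const, sub_self, add_zero] at h
    rw [LinearMap.comp_apply, T_single, posFunctional_single, ← h]
    cases nonempty_fintype (K p ⧸ (I p).subgroupOf (K p))
    simp only [finsum_eq_sum_of_fintype, map_sum, posFunctional_single]
    rfl
  exact congr($this x)

theorem heckeIdeal_le_ker_posFunctional :
    heckeIdeal (triv p k) 1 ≤ LinearMap.ker (posFunctional p k) := by
  refine sup_le ?_ ?_
  · rintro _ ⟨x, rfl⟩
    simp [posFunctional_T]
  · rintro _ ⟨x, rfl⟩
    simp [posFunctional_S]

/-- At the identity the rows are the standard basis vectors, whose kernels are the points `(0 : 1)`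
and `(1 : 0)`. The total term drops out by `finsum_symToMap`. -/
theorem posFunctional_phi (ℓ : Module.Dual k (SymPow k (p - 1))) :
    posFunctional p k (phi p k (single (resK p (symDual p k (p - 1))) 1 ℓ)) =
      ℓ (vecPow (p - 1) ![0, 1]) - ℓ (vecPow (p - 1) ![1, 0]) := by
  have hrow : ∀ i, (1 : G p).1 i =
      (p : ℚ_[p]) ^ (0 : ℤ) • fun j => (((1 : Matrix (Fin 2) (Fin 2) ℤ_[p]) i j : ℤ_[p]) : ℚ_[p]) := by
    intro i
    ext j
    by_cases h : i = j <;> simp [Matrix.one_apply, h]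
  have hone : ∀ i, (fun j => PadicInt.toZMod ((1 : Matrix (Fin 2) (Fin 2) ℤ_[p]) i j)) =
      (1 : Matrix (Fin 2) (Fin 2) (ZMod p)) i := by
    intro i
    ext j
    fin_cases i <;> fin_cases j <;> simp
  have hprim : ∀ i, IsPrimitive ((1 : Matrix (Fin 2) (Fin 2) ℤ_[p]) i) := by
    intro i h
    rw [hone] at h
    simpa using congr_fun h i
  have hv₀ : (![0, 1] : Fin 2 → ZMod p) ≠ 0 := by simp
  have hv₁ : (![1, 0] : Fin 2 → ZMod p) ≠ 0 := by simp
  obtain ⟨κ₀, hκ₀⟩ := exists_firstCol_eq p ![0, 1] hv₀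
  obtain ⟨κ₁, hκ₁⟩ := exists_firstCol_eq p ![1, 0] hv₁
  have h := finsum_apartmentPos 1 (hprim 0) (hprim 1) (hrow 0) (hrow 1) (κ₀ := κ₀) (κ₁ := κ₁)
    (by rw [hone, hκ₀]; simp [dotProduct]) (by rw [hone, hκ₁]; simp [dotProduct])
    (symToMap p k ℓ)
  rw [finsum_symToMap, mul_zero, zero_add, line, line, symToMap_mk, symToMap_mk, hκ₀, hκ₁] at h
  have e₀ : (fun i => algebraMap (ZMod p) k ((![0, 1] : Fin 2 → ZMod p) i)) = ![0, 1] := by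
    ext i; fin_cases i <;> simp
  have e₁ : (fun i => algebraMap (ZMod p) k ((![1, 0] : Fin 2 → ZMod p) i)) = ![1, 0] := by
    ext i; fin_cases i <;> simp
  rw [e₀, e₁] at h
  rw [phi_single, ← h]
  cases nonempty_fintype (K p ⧸ (I p).subgroupOf (K p))
  simp only [finsum_eq_sum_of_fintype, map_sum, posFunctional_single]

/-! ### The induced map `π(p - 1, 1, 1) → π(0, 1, 1)` -/

theorem phi_S (y : cInd (K p) (resK p (symDual p k (p - 1)))) :
    phi p k (S (symDual p k (p - 1)) y) = S (triv p k) (phi p k y) :=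
  phi_cIndRep (β p) y

theorem heckeIdeal_le_comap_phi (lam : k) :
    heckeIdeal (symDual p k (p - 1)) lam ≤ (heckeIdeal (triv p k) lam).comap (phi p k) := by
  refine sup_le ?_ ?_
  · rintro _ ⟨f, rfl⟩
    exact Submodule.mem_sup_left ⟨phi p k f, by
      refine Eq.trans ?_ ((phi p k).map_sub (T (symDual p k (p - 1)) f) (lam • f)).symm
      rw [phi_T, map_smul]
      rfl⟩
  · rintro _ ⟨f, rfl⟩
    exact Submodule.mem_sup_right ⟨phi p k f, by
      refine Eq.trans ?_ ((phi p k).map_sub (S (symDual p k (p - 1)) f) f).symm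
      rw [phi_S]
      rfl⟩

variable (p k) in
/-- The reduction of `φ` modulo `(T - 1, S - 1)`. -/
def phiQuot : HeckeQuot (symDual p k (p - 1)) 1 →ₗ[k] HeckeQuot (triv p k) 1 :=
  Submodule.mapQ _ _ (phi p k) (heckeIdeal_le_comap_phi 1)

/-- Since `ω` takes values in `𝔽_p^×`, the twist in `π(p - 1, 1, 1)` is trivial, like that in `π(0,
1, 1)`; equivariance of `φ` then needs no correction. -/
theorem omegaK_pow_sub_one : omegaK p k ^ (p - 1) = 1 := by
  ext x
  have : omega p x ^ (p - 1) = 1 := ZMod.units_pow_card_sub_one_eq_one p _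
  rw [MonoidHom.pow_apply, omegaK, MonoidHom.comp_apply, ← map_pow, this, map_one]
  rfl

theorem phiQuot_piRep (g : G p) (v : HeckeQuot (symDual p k (p - 1)) 1) :
    phiQuot p k (piRep (symDual p k (p - 1)) (p - 1) 1 1 g v) =
      piRep (triv p k) 0 1 1 g (phiQuot p k v) := by
  obtain ⟨y, rfl⟩ := Submodule.Quotient.mk_surjective _ v
  rw [piRep, piRep, omegaK_pow_sub_one, pow_zero (omegaK p k)]
  refine (map_smul (phiQuot p k) _ ((heckeIdeal (symDual p k (p - 1)) 1).mkQ
    (cIndRep _ g y))).trans (congr_arg _ ?_)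
  exact congr_arg (heckeIdeal (triv p k) 1).mkQ (phi_cIndRep g y)

theorem exists_dual_vecPow_ne (k : Type*) [Field k] {r : ℕ} (hr : r ≠ 0) :
    ∃ ℓ : Module.Dual k (SymPow k r), ℓ (vecPow r ![0, 1]) - ℓ (vecPow r ![1, 0]) ≠ 0 := by
  -- The functional is the coefficient of `X 1 ^ r`; it is `1` on `(0, 1)^r`, and `0` on `(1, 0)^r`
  -- because `r ≠ 0`.
  refine ⟨MvPolynomial.lcoeff k (Finsupp.single 1 r) ∘ₗ Submodule.subtype _, ?_⟩
  have h1 : (Finsupp.single 0 r : Fin 2 →₀ ℕ) ≠ Finsupp.single 1 r := by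
    rw [Ne, Finsupp.single_eq_single_iff]
    simp [hr]
  simp [vecPow, linForm, Fin.sum_univ_two, MvPolynomial.coeff_X_pow, h1]

theorem phiQuot_ne_zero : phiQuot p k ≠ 0 := by
  intro h
  obtain ⟨ℓ, hℓ⟩ := exists_dual_vecPow_ne k (r := p - 1)
    (Nat.sub_ne_zero_of_lt (Fact.out : p.Prime).one_lt)
  have h1 := congr($h (Submodule.Quotient.mk (single (resK p (symDual p k (p - 1))) 1 ℓ)))
  have h2 := heckeIdeal_le_ker_posFunctional ((Submodule.Quotient.mk_eq_zero _).1 h1)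
  rw [LinearMap.mem_ker, posFunctional_phi] at h2
  exact hℓ h2

end Functional

end ModPGL2

end

theorem mainTheorem7 (p : ℕ) [Fact p.Prime] (k : Type*) [Field k] [Algebra (ZMod p) k]
    [IsAlgClosure (ZMod p) k] :
    -- the composite of the decomposition and of `(φ₁, φ₂)` is `(1 0; T φ)`
    (∀ x y, ModPGL2.composite p k (x, y) =
      (x, ModPGL2.T (ModPGL2.triv p k) x + ModPGL2.phi p k y)) ∧
    -- `φ` is equivariant for `k[T, S]` and for `G`
    (∀ y, ModPGL2.phi p k (ModPGL2.T (ModPGL2.symDual p k (p - 1)) y) =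
      ModPGL2.T (ModPGL2.triv p k) (ModPGL2.phi p k y)) ∧
    (∀ y, ModPGL2.phi p k (ModPGL2.S (ModPGL2.symDual p k (p - 1)) y) =
      ModPGL2.S (ModPGL2.triv p k) (ModPGL2.phi p k y)) ∧
    (∀ g y, ModPGL2.phi p k (ModPGL2.cIndRep _ g y) =
      ModPGL2.cIndRep _ g (ModPGL2.phi p k y)) ∧
    -- `φ` induces a nonzero map `π(p-1, 1, 1) → π(0, 1, 1)`
    ∃ phiBar : ModPGL2.HeckeQuot (ModPGL2.symDual p k (p - 1)) 1 →ₗ[k]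
        ModPGL2.HeckeQuot (ModPGL2.triv p k) 1,
      (∀ y, phiBar (Submodule.Quotient.mk y) = Submodule.Quotient.mk (ModPGL2.phi p k y)) ∧
      (∀ g v, phiBar (ModPGL2.piRep (ModPGL2.symDual p k (p - 1)) (p - 1) 1 1 g v) =
        ModPGL2.piRep (ModPGL2.triv p k) 0 1 1 g (phiBar v)) ∧
      phiBar ≠ 0 := by
  exact ⟨ModPGL2.composite_apply, ModPGL2.phi_T, ModPGL2.phi_S, ModPGL2.phi_cIndRep,
    ModPGL2.phiQuot p k, fun _ => rfl, ModPGL2.phiQuot_piRep, ModPGL2.phiQuot_ne_zero⟩
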